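/- Let $n\ge 1$, let $B=\{(y',y_n)\in\mathbb R^{n-1}\times\mathbb R : |y'|^2<y_n\}$ and let $T_B=\{x+iy\in\mathbb C^n : x\in\mathbb R^n,\ y\in B\}$. For $z,w\in T_B$ put $$\rho(z,w)=\tfrac14\Big(\textstyle\sum_{j<n}(z_j-\overline{w_j})^2-2i(z_n-\overline{w_n})\Big),\qquad \rho(z)=\rho(z,z)=\operatorname{Im}z_n-\textstyle\sum_{j<n}(\operatorname{Im}z_j)^2>0 ;$$ $\rho(z,w)$ has positive real part, and its complex powers are taken with the principal branch. For $p>0$ and $\alpha>-1$ let $\|f\|_{p,\alpha}=\big(\int_{T_B}|f(z)|^p\rho(z)^\alpha\,dV(z)\big)^{1/p}$, where $V$ is Lebesgue measure; let $L^p_\alpha(T_B)$ be the space of measurable $f$ with $\|f\|_{p,\alpha}<\infty$ and $A^p_\alpha(T_B)$ the set of holomorphic functions in it. Let $\mathcal M_+$ be the set of positive Borel measures $\mu$ on $T_B$ such that $\int_{T_B}|\rho(z,\mathbf i)|^{-t}\,d\mu(z)<\infty$ for some $t>0$, where $\mathbf i=(0',i)$. For $\xi>-1$, $\mu\in\mathcal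 M_+$ and $f$ holomorphic on $T_B$ let $$B_\mu^\xi f(z)=\int_{T_B}\frac{|f(w)|}{|\rho(z,w)|^{n+1+\xi}}\,d\mu(w),\qquad T_\mu^\xi f(z)=\int_{T_B}\frac{f(w)}{\rho(z,w)^{n+1+\xi}}\,d\mu(w)\qquad(z\in T_B).$$ Boundedness of $T_\mu^\xi$ on $A^{p_1}_{\alpha_1}(T_B)$ includes that the integral defining $T_\mu^\xi f(z)$ converges absolutely for all $f\in A^{p_1}_{\alpha_1}(T_B)$ and $z\in T_B$. Operator norms are least bounds, equal to $\infty$ if the operator is not bounded. For $\lambda>0$ and $\alpha>-1$, $\mu$ is a $(\lambda,\alpha)$-Carleson measure if for all real $p,q>0$ with $q/p=\lambda$ there is a constant $C>0$ with $\int_{T_B}|f|^q\,d\mu\le C\|f\|_{p,\alpha}^q$ for all $f\in A^p_\alpha(T_B)$; and $\|\mu\|_{\lambda,\alpha}=\sup\{\int_{T_B}|f|^q\,d\mu : f\in A^p_\alpha(T_B),\ \|f\|_{p,\alpha}\le1\}$, computed with any such pair $p,q$. **Theorem.** Let $0<p_1\le p_2<\infty$ and $-1<\alpha_1,\alpha_2,\xi<\infty$,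 and suppose that $$n+1+\xi>n\max\Big(1,\frac1{p_i}\Big)+\frac{1+\alpha_i}{p_i},\qquad i=1,2.$$ Let $\lambda=1+\frac1{p_1}-\frac1{p_2}$ and $\gamma=\frac1\lambda\big(\xi+\frac{\alpha_1}{p_1}-\frac{\alpha_2}{p_2}\big)$. Then for every $\mu\in\mathcal M_+$ the following are equivalent: 1. $B_\mu^\xi$ is bounded from $A^{p_1}_{\alpha_1}(T_B)$ to $L^{p_2}_{\alpha_2}(T_B)$; 2. $T_\mu^\xi$ is bounded from $A^{p_1}_{\alpha_1}(T_B)$ to $A^{p_2}_{\alpha_2}(T_B)$; 3. $\mu$ is a $(\lambda,\gamma)$-Carleson measure. Moreover, $$\|B_\mu^\xi\|_{A^{p_1}_{\alpha_1}\to L^{p_2}_{\alpha_2}}\simeq\|T_\mu^\xi\|_{A^{p_1}_{\alpha_1}\to A^{p_2}_{\alpha_2}}\simeq\|\mu\|_{\lambda,\gamma},$$ where the constants of comparison depend only on $n,p_1,p_2,\alpha_1,\alpha_2,\xi$ (not on $\mu$, nor on the pair $p,q>0$ with $q/p=\lambda$ used to compute $\|\mu\|_{\lambda,\gamma}$). 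-/

import Mathlib

open MeasureTheory
open scoped ENNReal NNReal ComplexConjugate

namespace TubeBergman

/-- `ℂⁿ`, with the product topology and (as `volume`) Lebesgue measure. For `n ≠ 0` the index
`⊤ : Fin n` is the last one, so that `z ⊤` is `z_n` and the other coordinates form `z'`. -/
abbrev Cn (n : ℕ) : Type := Fin n → ℂ

/-- The base `B = {(y', y_n) ∈ ℝⁿ : |y'|² < y_n}`. -/
def base (n : ℕ) [NeZero n] : Set (Fin n → ℝ) :=
  {y | ∑ i ∈ Finset.univ.erase (⊤ : Fin n), y i ^ 2 < y ⊤}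

/-- The tubular domain `T_B = {x + iy : x ∈ ℝⁿ, y ∈ B}`. -/
def tube (n : ℕ) [NeZero n] : Set (Cn n) :=
  {z | (fun i => (z i).im) ∈ base n}

/-- `ρ(z, w) = ((z' - w̄')² - 2i (z_n - w̄_n)) / 4`. -/
noncomputable def rho {n : ℕ} [NeZero n] (z w : Cn n) : ℂ :=
  (1 / 4) * (∑ i ∈ Finset.univ.erase (⊤ : Fin n), (z i - conj (w i)) ^ 2
    - 2 * Complex.I * (z ⊤ - conj (w ⊤)))

/-- `ρ(z) = y_n - |y'|²`, where `y = Im z`; it equals `ρ(z, z)` by `rho_self`. -/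
noncomputable def rhoDiag {n : ℕ} [NeZero n] (z : Cn n) : ℝ :=
  (z ⊤).im - ∑ i ∈ Finset.univ.erase (⊤ : Fin n), (z i).im ^ 2

theorem rho_self {n : ℕ} [NeZero n] (z : Cn n) : rho z z = (rhoDiag z : ℂ) := by
  have h : ∀ w : ℂ, w - conj w = 2 * (w.im : ℂ) * Complex.I := by
    intro w
    apply Complex.ext <;> simp
    ring
  have h2 : ∀ t : ℂ, (2 * t * Complex.I) ^ 2 = -4 * t ^ 2 := by
    intro t
    rw [mul_pow, Complex.I_sq]
    ring
  simp only [rho, rhoDiag, h, h2, ← Finset.mul_sum]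
  push_cast
  linear_combination (-(1 : ℂ) * ((z ⊤).im : ℂ)) * Complex.I_sq

/-- On the tube `ρ(z, w)` lies in the right half plane, so that the principal branch of its powers,
which is the one of `Complex.cpow`, is holomorphic in `z`. -/
theorem rho_re_pos {n : ℕ} [NeZero n] {z w : Cn n} (hz : z ∈ tube n) (hw : w ∈ tube n) :
    0 < (rho z w).re := by
  have hz' : ∑ i ∈ Finset.univ.erase (⊤ : Fin n), (z i).im ^ 2 < (z ⊤).im := hz
  have hw' : ∑ i ∈ Finset.univ.erase (⊤ : Fin n), (w i).im ^ 2 < (w ⊤).im := hw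
  have key : -(2 * ∑ i ∈ Finset.univ.erase (⊤ : Fin n), (z i).im ^ 2
      + 2 * ∑ i ∈ Finset.univ.erase (⊤ : Fin n), (w i).im ^ 2)
      ≤ ∑ i ∈ Finset.univ.erase (⊤ : Fin n), ((z i - conj (w i)) ^ 2).re := by
    rw [Finset.mul_sum, Finset.mul_sum, ← Finset.sum_add_distrib, ← Finset.sum_neg_distrib]
    refine Finset.sum_le_sum fun i _ => ?_
    have : ((z i - conj (w i)) ^ 2).re
        = ((z i).re - (w i).re) ^ 2 - ((z i).im + (w i).im) ^ 2 := by
      rw [pow_two, Complex.mul_re]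
      simp
      ring
    rw [this]
    nlinarith [sq_nonneg ((z i).re - (w i).re), sq_nonneg ((z i).im - (w i).im)]
  have e : (rho z w).re = 1 / 4 * (∑ i ∈ Finset.univ.erase (⊤ : Fin n),
      ((z i - conj (w i)) ^ 2).re + 2 * ((z ⊤).im + (w ⊤).im)) := by
    have h4 : (1 / 4 : ℂ) = ((1 / 4 : ℝ) : ℂ) := by push_cast; rfl
    rw [rho, h4, Complex.re_ofReal_mul, Complex.sub_re, Complex.re_sum]
    simp
  rw [e]
  linarith

/-- The base point `𝐢 = (0', i)`. -/
noncomputable def basePt (n : ℕ) [NeZero n] : Cn n := Pi.single ⊤ Complex.I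

/-- `(∫_{T_B} g(z)^p dV_α(z))^{1/p}` with `dV_α(z) = ρ(z)^α dV(z)`, for a function `g` with values
in `[0, ∞]`. -/
noncomputable def weightedNorm {n : ℕ} [NeZero n] (p α : ℝ) (g : Cn n → ℝ≥0∞) : ℝ≥0∞ :=
  (∫⁻ z in tube n, g z ^ p * ENNReal.ofReal (rhoDiag z ^ α)) ^ (1 / p)

/-- `‖f‖_{p,α}` for a complex valued function `f`. Functions on the tube are represented by
functions on `ℂⁿ`; their values off the tube play no role. -/
noncomputable def bergmanNorm {n : ℕ} [NeZero n] (p α : ℝ) (f : Cn n → ℂ) : ℝ≥0∞ :=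
  weightedNorm p α fun z => ‖f z‖ₑ

/-- The nonnegative elements of `L^p_α(T_B)`, as functions with values in `[0, ∞]`. -/
def NonnegLpSpace (n : ℕ) [NeZero n] (p α : ℝ) : Set (Cn n → ℝ≥0∞) :=
  {g | AEMeasurable g (volume.restrict (tube n)) ∧ weightedNorm p α g < ∞}

/-- The Bergman space `A^p_α(T_B)`: holomorphic functions on the tube with finite `‖f‖_{p,α}`. -/
def BergmanSpace (n : ℕ) [NeZero n] (p α : ℝ) : Set (Cn n → ℂ) :=
  {f | DifferentiableOn ℂ f (tube n) ∧ bergmanNorm p α f < ∞}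

/-- The class `𝓜₊` of positive Borel measures `μ` on `T_B` with
`∫_{T_B} |ρ(z, 𝐢)|^{-t} dμ(z) < ∞` for some `t > 0`. A measure on `T_B` is represented by a measure
on `ℂⁿ`, of which only the restriction to `T_B` is ever used. -/
def MPlus (n : ℕ) [NeZero n] : Set (Measure (Cn n)) :=
  {μ | ∃ t : ℝ, 0 < t ∧ ∫⁻ z in tube n, (‖rho z (basePt n)‖ₑ ^ t)⁻¹ ∂μ < ∞}

/-- The Berezin-type operator
`B_μ^ξ f(z) = ∫_{T_B} |f(w)| / |ρ(z, w)|^{n+1+ξ} dμ(w)`, with values in `[0, ∞]`. -/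
noncomputable def berezin {n : ℕ} [NeZero n] (μ : Measure (Cn n)) (ξ : ℝ) (f : Cn n → ℂ)
    (z : Cn n) : ℝ≥0∞ :=
  ∫⁻ w in tube n, ‖f w‖ₑ / ‖rho z w‖ₑ ^ ((n : ℝ) + 1 + ξ) ∂μ

/-- The integrand `f(w) / ρ(z, w)^{n+1+ξ}` of the Toeplitz operator (principal branch). -/
noncomputable def toeplitzIntegrand {n : ℕ} [NeZero n] (ξ : ℝ) (f : Cn n → ℂ) (z w : Cn n) : ℂ :=
  f w / rho z w ^ (((n : ℝ) + 1 + ξ : ℝ) : ℂ)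

/-- The Toeplitz operator `T_μ^ξ f(z) = ∫_{T_B} f(w) / ρ(z, w)^{n+1+ξ} dμ(w)`. -/
noncomputable def toeplitz {n : ℕ} [NeZero n] (μ : Measure (Cn n)) (ξ : ℝ) (f : Cn n → ℂ)
    (z : Cn n) : ℂ :=
  ∫ w in tube n, toeplitzIntegrand ξ f z w ∂μ

/-- `B_μ^ξ` maps `A^{p₁}_{α₁}` into `L^{p₂}_{α₂}`, with `‖B_μ^ξ f‖ ≤ C ‖f‖`. -/
def BerezinBoundedBy {n : ℕ} [NeZero n] (p₁ α₁ p₂ α₂ ξ : ℝ) (μ : Measure (Cn n)) (C : ℝ≥0) :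
    Prop :=
  ∀ f ∈ BergmanSpace n p₁ α₁,
    berezin μ ξ f ∈ NonnegLpSpace n p₂ α₂ ∧
    weightedNorm p₂ α₂ (berezin μ ξ f) ≤ C * bergmanNorm p₁ α₁ f

/-- `T_μ^ξ` is defined on `A^{p₁}_{α₁}` (the integrals converge absolutely at every point of the
tube) and maps it into `A^{p₂}_{α₂}`, with `‖T_μ^ξ f‖ ≤ C ‖f‖`. -/
def ToeplitzBoundedBy {n : ℕ} [NeZero n] (p₁ α₁ p₂ α₂ ξ : ℝ) (μ : Measure (Cn n)) (C : ℝ≥0) :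
    Prop :=
  ∀ f ∈ BergmanSpace n p₁ α₁,
    (∀ z ∈ tube n, IntegrableOn (toeplitzIntegrand ξ f z) (tube n) μ) ∧
    toeplitz μ ξ f ∈ BergmanSpace n p₂ α₂ ∧
    bergmanNorm p₂ α₂ (toeplitz μ ξ f) ≤ C * bergmanNorm p₁ α₁ f

/-- `B_μ^ξ` is bounded from `A^{p₁}_{α₁}(T_B)` to `L^{p₂}_{α₂}(T_B)`. -/
def BerezinBounded {n : ℕ} [NeZero n] (p₁ α₁ p₂ α₂ ξ : ℝ) (μ : Measure (Cn n)) : Prop :=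
  ∃ C : ℝ≥0, BerezinBoundedBy p₁ α₁ p₂ α₂ ξ μ C

/-- `T_μ^ξ` is bounded from `A^{p₁}_{α₁}(T_B)` to `A^{p₂}_{α₂}(T_B)`. -/
def ToeplitzBounded {n : ℕ} [NeZero n] (p₁ α₁ p₂ α₂ ξ : ℝ) (μ : Measure (Cn n)) : Prop :=
  ∃ C : ℝ≥0, ToeplitzBoundedBy p₁ α₁ p₂ α₂ ξ μ C

/-- The operator norm of `B_μ^ξ : A^{p₁}_{α₁} → L^{p₂}_{α₂}`, the least bound; it is `∞` if the
operator is not bounded. -/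
noncomputable def berezinNorm {n : ℕ} [NeZero n] (p₁ α₁ p₂ α₂ ξ : ℝ) (μ : Measure (Cn n)) :
    ℝ≥0∞ :=
  ⨅ (C : ℝ≥0) (_ : BerezinBoundedBy p₁ α₁ p₂ α₂ ξ μ C), (C : ℝ≥0∞)

/-- The operator norm of `T_μ^ξ : A^{p₁}_{α₁} → A^{p₂}_{α₂}`, the least bound; it is `∞` if the
operator is not bounded. -/
noncomputable def toeplitzNorm {n : ℕ} [NeZero n] (p₁ α₁ p₂ α₂ ξ : ℝ) (μ : Measure (Cn n)) :
    ℝ≥0∞ :=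
  ⨅ (C : ℝ≥0) (_ : ToeplitzBoundedBy p₁ α₁ p₂ α₂ ξ μ C), (C : ℝ≥0∞)

/-- `μ` is a `(lam, α)`-Carleson measure: for all positive reals `p`, `q` with `q / p = lam` there
is `C` with `∫_{T_B} |f|^q dμ ≤ C ‖f‖_{p,α}^q` for every `f ∈ A^p_α(T_B)`. -/
def IsCarleson {n : ℕ} [NeZero n] (lam α : ℝ) (μ : Measure (Cn n)) : Prop :=
  ∀ p q : ℝ, 0 < p → 0 < q → q / p = lam →
    ∃ C : ℝ≥0, ∀ f ∈ BergmanSpace n p α,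
      ∫⁻ z in tube n, ‖f z‖ₑ ^ q ∂μ ≤ C * bergmanNorm p α f ^ q

/-- `sup {∫_{T_B} |f|^q dμ : f ∈ A^p_α(T_B), ‖f‖_{p,α} ≤ 1}`; for `q / p = lam` this is the norm
`‖μ‖_{lam,α}`, computed with the exponents `p` and `q`. -/
noncomputable def carlesonNorm {n : ℕ} [NeZero n] (p q α : ℝ) (μ : Measure (Cn n)) : ℝ≥0∞ :=
  ⨆ (f : Cn n → ℂ) (_ : f ∈ BergmanSpace n p α) (_ : bergmanNorm p α f ≤ 1),
    ∫⁻ z in tube n, ‖f z‖ₑ ^ q ∂μ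

end TubeBergman

/-! ### Preliminaries on product integrals, subharmonicity and holomorphic parameter integrals. -/

namespace TubeBergman

/-! All three conditions are compared with one geometric condition, `μ (dualDisc u) ≤ M ρ(u)^κ` on
the tube, where κ = λ(n+1+γ) = n+1+ξ + (n+1+α₁)/p₁ - (n+1+α₂)/p₂ and `dualDisc u` consists of the
points whose adapted polydisc contains u. The best M, `geometricNorm κ μ`, turns out to be
comparable with each of the three norms. No lattice, covering or duality argument enters.

The polydiscs `disc a` have size √ρ(a) in the front coordinates and ρ(a) in the linear form
`tangential a`. On them ρ and ρ(z, ·) are constant up to a factor 2, and their volume is a multiple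
of ρ(a)^(n+1). Plurisubharmonicity of |f|^p gives a mean value inequality on them, hence a growth
estimate and the embeddings of A^p_α for p ≤ q (`exists_lintegral_le_rpow`). Integrating the mean
value inequality against μ and exchanging the integrals bounds ∫|f|^q dμ by `geometricNorm κ μ`
times ∫|f|^q ρ^(κ-n-1) dV (`exists_lintegral_le_geometricNorm`).

Sufficiency: since λ ≥ 1, this bound and the embedding give the Carleson inequality. For q = 1 and w
↦ f(w) ρ(w,z)^(-(n+1+ξ)) it bounds B f(z). The p₂-th power is handled by an embedding if p₂ ≤ 1 and
by Hölder and Forelli–Rudin if p₂ > 1. Integration in z by Forelli–Rudin, followed by the embedding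
for p₁ ≤ p₂, bounds the norm of B f. Finally |T f| ≤ B f.

Necessity: one tests on powers of ρ(·, a), whose norms are controlled by `exists_lintegral_rho_le`.
For the Toeplitz operator the power n+1+ξ is chosen: the integrand of T f(a) is then
|ρ(a,w)|^(-2(n+1+ξ)), so nothing cancels, and the growth estimate bounds |T f(a)|. -/

theorem lintegral_fin_prod {E : Type*} [MeasureSpace E] [SigmaFinite (volume : Measure E)] {n : ℕ}
    (f : Fin n → E → ℝ≥0∞) (hf : ∀ i, Measurable (f i)) :
    ∫⁻ x : Fin n → E, ∏ i, f i (x i) = ∏ i, ∫⁻ t, f i t := by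
  induction n with
  | zero => simp [lintegral_const, volume_pi]
  | succ n ih =>
    rw [← ((volume_preserving_piFinSuccAbove (fun _ : Fin (n + 1) => E) 0).symm).lintegral_comp
      (by fun_prop)]
    simp_rw [MeasurableEquiv.piFinSuccAbove_symm_apply, Fin.insertNthEquiv,
        Fin.prod_univ_succ]
    simp only [Equiv.coe_fn_mk, Fin.insertNth_zero, Fin.cons_zero, Fin.cons_succ]
    rw [← ih (fun i => f i.succ) (fun i => hf _)]
    exact lintegral_prod_mul (μ := (volume : Measure E)) (ν := (volume : Measure (Fin n → E))) (f := f 0) (g := fun x : Fin n → E => ∏ i, f i.succ (x i))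
      (hf 0).aemeasurable (Finset.measurable_fun_prod _ fun i _ =>
        (hf i.succ).comp (measurable_pi_apply i)).aemeasurable

/-- A shear in one coordinate, by a function of the other coordinates, preserves the volume. -/
theorem measurePreserving_shear {ι : Type*} [Fintype ι] [DecidableEq ι] (i : ι)
    {φ : (ι → ℂ) → ℂ} (hφ : Measurable φ) (hi : ∀ w ζ, φ (Function.update w i ζ) = φ w) :
    MeasurePreserving (fun w : ι → ℂ => Function.update w i (w i + φ w)) := by
  have hm : Measurable (fun w : ι → ℂ => Function.update w i (w i + φ w)) := by
    refine measurable_pi_iff.2 fun j => ?_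
    by_cases h : j = i
    · subst h
      simpa using! (measurable_pi_apply j).add hφ
    · simpa [Function.update_of_ne h] using measurable_pi_apply j
  refine ⟨hm, Measure.ext_of_lintegral _ fun F hF => ?_⟩
  rw [lintegral_map hF hm, volume_pi]
  -- Integrating the coordinate `i` first, with the others fixed, leaves a translation of `ℂ`.
  refine lintegral_eq_of_lmarginal_eq {i} (hF.comp hm) hF ?_
  rw [lmarginal_singleton, lmarginal_singleton]
  funext w
  simp only [Function.update_self, Function.update_idem, hi]
  exact lintegral_add_right_eq_self (fun ζ => F (Function.update w i ζ)) (φ w)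

theorem lintegral_comp_real_smul {E : Type*} [NormedAddCommGroup E] [NormedSpace ℝ E]
    [MeasurableSpace E] [BorelSpace E] [FiniteDimensional ℝ E] (μ : Measure E)
    [μ.IsAddHaarMeasure] (f : E → ℝ≥0∞) (hf : Measurable f) {r : ℝ} (hr : r ≠ 0) :
    ∫⁻ x, f (r • x) ∂μ = ENNReal.ofReal |(r ^ Module.finrank ℝ E)⁻¹| * ∫⁻ x, f x ∂μ := by
  rw [← smul_eq_mul, ← lintegral_smul_measure, ← Measure.map_addHaar_smul μ hr,
    lintegral_map hf (measurable_const_smul r)]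

/-- **Jensen's inequality** for analytic functions: `log |h|` has the sub-mean value property. -/
theorem log_norm_le_circleAverage {h : ℂ → ℂ} (hh : AnalyticOnNhd ℂ h (Metric.closedBall 0 1))
    (h0 : h 0 ≠ 0) :
    Real.log ‖h 0‖ ≤ Real.circleAverage (fun z => Real.log ‖h z‖) 0 1 := by
  have hh' : AnalyticOnNhd ℂ h (Metric.closedBall 0 |1|) := by rwa [abs_one]
  rw [hh'.circleAverage_log_norm one_ne_zero h0]
  refine le_add_of_nonneg_left (finsum_nonneg fun u => ?_)
  by_cases hu : u ∈ Metric.closedBall (0 : ℂ) |1|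
  · refine mul_nonneg ?_ ?_
    · exact_mod_cast MeromorphicOn.AnalyticOnNhd.divisor_nonneg hh' u
    -- In Jensen's formula a zero `u` contributes its order times `log |u|⁻¹ ≥ 0`; at `u = 0` this
    -- logarithm is `0` by convention.
    · rcases eq_or_ne u 0 with rfl | hu0
      · simp
      · apply Real.log_nonneg
        rw [one_mul, zero_sub, norm_neg]
        apply (one_le_inv₀ (norm_pos_iff.2 hu0)).2
        simpa using hu
  · rw [Function.locallyFinsuppWithin.apply_eq_zero_of_notMem _ hu]
    simp

theorem circleIntegrable_rpow_norm {h : ℂ → ℂ}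
    (hh : AnalyticOnNhd ℂ h (Metric.closedBall 0 1)) {p : ℝ} (hp : 0 < p) :
    CircleIntegrable (fun z => ‖h z‖ ^ p) 0 1 :=
  ((hh.continuousOn.mono Metric.sphere_subset_closedBall).norm.rpow_const
    fun _ _ => Or.inr hp.le).circleIntegrable zero_le_one

/-- Jensen's inequality combined with e·x ≤ e^x at x = p log|h|. It is linear in log|h(0)| and
becomes sharp after rescaling `h`, which gives the sub-mean value property of |h|^p without a
convexity argument. -/
theorem exp_one_mul_log_le_circleAverage {h : ℂ → ℂ}
    (hh : AnalyticOnNhd ℂ h (Metric.closedBall 0 1)) (h0 : h 0 ≠ 0) {p : ℝ} (hp : 0 < p) :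
    Real.exp 1 * p * Real.log ‖h 0‖ ≤ Real.circleAverage (fun z => ‖h z‖ ^ p) 0 1 := by
  have hmer : MeromorphicOn h (Metric.sphere 0 |1|) := by
    rw [abs_one]
    exact (hh.mono Metric.sphere_subset_closedBall).meromorphicOn
  have hlog : CircleIntegrable (fun z => Real.log ‖h z‖) 0 1 := hmer.circleIntegrable_log_norm
  calc _ ≤ Real.exp 1 * p * Real.circleAverage (fun z => Real.log ‖h z‖) 0 1 := by
        gcongr
        exact log_norm_le_circleAverage hh h0
    _ = Real.circleAverage (fun z => (Real.exp 1 * p) • Real.log ‖h z‖) 0 1 := by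
        rw [Real.circleAverage_fun_smul, smul_eq_mul]
    _ ≤ _ := by
        refine Real.circleAverage_mono (IntervalIntegrable.const_mul hlog _)
          (circleIntegrable_rpow_norm hh hp) fun z _ => ?_
        rcases eq_or_ne (h z) 0 with hz | hz
        · simp [hz, Real.zero_rpow hp.ne']
        · rw [Real.rpow_def_of_pos (norm_pos_iff.2 hz), smul_eq_mul]
          have := Real.add_one_le_exp (Real.log ‖h z‖ * p - 1)
          rw [sub_add_cancel, Real.exp_sub, le_div_iff₀ (Real.exp_pos 1)] at this
          linarith

/-- The sub-mean value property of `|h|^p` on the unit circle, for all `p > 0`. -/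
theorem rpow_norm_le_circleAverage {h : ℂ → ℂ} (hh : AnalyticOnNhd ℂ h (Metric.closedBall 0 1))
    {p : ℝ} (hp : 0 < p) :
    ‖h 0‖ ^ p ≤ Real.circleAverage (fun z => ‖h z‖ ^ p) 0 1 := by
  rcases eq_or_ne (h 0) 0 with h0 | h0
  · rw [h0, norm_zero, Real.zero_rpow hp.ne']
    exact Real.circleAverage_nonneg_of_nonneg fun z _ => by positivity
  have hpos : 0 < ‖h 0‖ := norm_pos_iff.2 h0
  -- normalise `h` so that `e ^ x ≥ e * x` is an equality at `x = p * log |h 0|`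
  set s : ℝ := Real.exp (1 / p) / ‖h 0‖ with hs
  have hspos : 0 < s := by positivity
  have hsn : ∀ z, ‖(s : ℂ) * h z‖ = s * ‖h z‖ := fun z => by
    rw [norm_mul, Complex.norm_real, Real.norm_of_nonneg hspos.le]
  have hs0 : s * ‖h 0‖ = Real.exp (1 / p) := by rw [hs]; field_simp
  have key := exp_one_mul_log_le_circleAverage (h := fun z => (s : ℂ) * h z)
    (analyticOnNhd_const.mul hh) (by simp [h0, hspos.ne']) hp
  simp only [hsn, Real.mul_rpow hspos.le (norm_nonneg _)] at key
  simp only [← smul_eq_mul (s ^ p)] at key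
  rw [Real.circleAverage_fun_smul, hs0, Real.log_exp, mul_assoc, mul_one_div_cancel hp.ne',
    mul_one, smul_eq_mul] at key
  have hsp : Real.exp 1 = s ^ p * ‖h 0‖ ^ p := by
    rw [← Real.mul_rpow hspos.le (norm_nonneg _), hs0, ← Real.exp_mul, one_div_mul_cancel hp.ne']
  rw [hsp] at key
  exact le_of_mul_le_mul_left key (by positivity)

/-- A parametric integral of holomorphic functions which is locally dominated is holomorphic. -/
theorem differentiableOn_integral_of_dominated {n : ℕ} {X : Type*} [MeasurableSpace X]
    {μ : Measure X} {U : Set (Cn n)} (hU : IsOpen U) {F : Cn n → X → ℂ}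
    (hmeas : ∀ z ∈ U, AEStronglyMeasurable (F z) μ)
    (hdiff : ∀ᵐ x ∂μ, DifferentiableOn ℂ (fun z => F z x) U)
    (hdom : ∀ z₀ ∈ U, ∃ V ∈ nhds z₀, ∃ g : X → ℝ, Integrable g μ ∧
      ∀ᵐ x ∂μ, ∀ z ∈ V, ‖F z x‖ ≤ g x) :
    DifferentiableOn ℂ (fun z => ∫ x, F z x ∂μ) U := by
  intro z₀ hz₀
  obtain ⟨V, hV, g, hg, hVg⟩ := hdom z₀ hz₀
  obtain ⟨r, hr, hball⟩ := Metric.mem_nhds_iff.1 (Filter.inter_mem hV (hU.mem_nhds hz₀))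
  have hat : ∀ᵐ x ∂μ, ∀ z ∈ Metric.ball z₀ r, DifferentiableAt ℂ (fun z => F z x) z := by
    filter_upwards [hdiff] with x hx z hz
    exact hx.differentiableAt (hU.mem_nhds (hball hz).2)
  -- Cauchy's estimate on a ball of radius r/2, where F(·, x) stays within 2 g(x) of its value at
  -- the centre.
  have hbound : ∀ᵐ x ∂μ, ∀ z ∈ Metric.ball z₀ (r / 2),
      ‖fderiv ℂ (fun z => F z x) z‖ ≤ 2 * g x / (r / 2) := by
    filter_upwards [hat, hVg] with x hx hgx z hz
    have hsub : Metric.ball z (r / 2) ⊆ Metric.ball z₀ r :=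
      Metric.ball_subset_ball' (by rw [Metric.mem_ball] at hz; linarith)
    refine Complex.norm_fderiv_le_div_of_mapsTo_ball
      (fun y hy => (hx y (hsub hy)).differentiableWithinAt) (fun y hy => ?_) (by positivity)
    rw [Metric.mem_closedBall, dist_eq_norm]
    have h1 := hgx y (hball (hsub hy)).1
    have h2 := hgx z (hball (hsub (Metric.mem_ball_self (by positivity)))).1
    linarith [norm_sub_le (F y x) (F z x)]
  -- Each partial derivative is a pointwise limit of difference quotients along a sequence of
  -- increments tending to 0, hence measurable in x.
  have hmeas' : AEStronglyMeasurable (fun x => fderiv ℂ (fun z => F z x) z₀) μ := by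
    have hpartial : ∀ i : Fin n, AEStronglyMeasurable
        (fun x => fderiv ℂ (fun z => F z x) z₀ (Pi.single i 1)) μ := by
      intro i
      set c : ℕ → ℝ := fun k => (r / 2) / (k + 1) with hc
      have hcpos : ∀ k, 0 < c k := fun k => by positivity
      have hc0 : Filter.Tendsto c Filter.atTop (nhds 0) :=
        by simpa [hc, div_eq_mul_one_div (r / 2)] using
          tendsto_one_div_add_atTop_nhds_zero_nat.const_mul (r / 2)
      have hcU : ∀ k, z₀ + (c k : ℂ) • Pi.single i 1 ∈ U := fun k => by
        refine (hball ?_).2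
        rw [mem_ball_iff_norm, add_sub_cancel_left, norm_smul, Pi.norm_single, norm_one, mul_one,
          Complex.norm_real, Real.norm_of_nonneg (hcpos k).le]
        calc c k ≤ r / 2 := div_le_self (by positivity) (by linarith [k.cast_nonneg (α := ℝ)])
          _ < r := by linarith
      refine aestronglyMeasurable_of_tendsto_ae Filter.atTop
        (f := fun k x => (c k : ℂ)⁻¹ • (F (z₀ + (c k : ℂ) • Pi.single i 1) x - F z₀ x))
        (fun k => ((hmeas _ (hcU k)).sub (hmeas _ hz₀)).const_smul (c k : ℂ)⁻¹) ?_
      filter_upwards [hat] with x hx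
      have h1 := (hx z₀ (Metric.mem_ball_self hr)).hasFDerivAt.hasLineDerivAt (Pi.single i 1)
      have h2 := h1.tendsto_slope_zero
      refine h2.comp (tendsto_nhdsWithin_iff.2 ⟨?_, Filter.Eventually.of_forall fun k => ?_⟩)
      · simpa using! (Complex.continuous_ofReal.tendsto 0).comp hc0
      · simpa using (hcpos k).ne'
    have hsum : (fun x => fderiv ℂ (fun z => F z x) z₀) = fun x => ∑ i : Fin n,
        fderiv ℂ (fun z => F z x) z₀ (Pi.single i 1) •
          (ContinuousLinearMap.proj i : Cn n →L[ℂ] ℂ) := by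
      funext x
      ext v
      conv_lhs => rw [pi_eq_sum_univ' v, map_sum]
      simp only [map_smul, sum_apply, smul_apply, ContinuousLinearMap.proj_apply, smul_eq_mul,
        mul_comm]
    rw [hsum]
    exact Finset.aestronglyMeasurable_fun_sum _ fun i _ => (hpartial i).smul_const _
  have hU' : ∀ᶠ z in nhds z₀, AEStronglyMeasurable (F z) μ := by
    filter_upwards [hU.mem_nhds hz₀] with z hz using hmeas z hz
  have hint : Integrable (F z₀) μ := hg.mono' (hmeas z₀ hz₀) <| by
    filter_upwards [hVg] with x hx using hx z₀ (mem_of_mem_nhds hV)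
  refine (hasFDerivAt_integral_of_dominated_of_fderiv_le (s := Metric.ball z₀ (r / 2))
    (Metric.ball_mem_nhds z₀ (by positivity)) hU' hint hmeas' hbound
    ((hg.const_mul 2).div_const _) ?_).differentiableAt.differentiableWithinAt
  filter_upwards [hat] with x hx z hz
  exact (hx z (Metric.ball_subset_ball (by linarith) hz)).hasFDerivAt


/-- The indices of the coordinates `z' = (z₁, …, z_{n-1})`. -/
abbrev front (n : ℕ) [NeZero n] : Finset (Fin n) := Finset.univ.erase ⊤

/-! ### Geometry of ρ and of the adapted polydiscs. -/

section Geometry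
variable {n : ℕ} [NeZero n]

theorem rhoDiag_pos {z : Cn n} (hz : z ∈ tube n) : 0 < rhoDiag z := sub_pos.2 hz

theorem mem_tube_iff {z : Cn n} : z ∈ tube n ↔ 0 < rhoDiag z :=
  ⟨rhoDiag_pos, fun h => sub_pos.1 h⟩

@[fun_prop]
theorem continuous_rhoDiag : Continuous (rhoDiag : Cn n → ℝ) := by
  unfold rhoDiag; fun_prop

theorem continuous_rho : Continuous fun x : Cn n × Cn n => rho x.1 x.2 := by
  unfold rho; fun_prop

theorem isOpen_tube : IsOpen (tube n) := by
  have h : tube n = {z | 0 < rhoDiag z} := Set.ext fun z => mem_tube_iff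
  rw [h]
  exact isOpen_lt continuous_const continuous_rhoDiag

theorem measurableSet_tube : MeasurableSet (tube n) := isOpen_tube.measurableSet

theorem rho_conj (z w : Cn n) : conj (rho z w) = rho w z := by
  simp only [rho, map_mul, map_sub, map_sum, map_pow, Complex.conj_conj, map_div₀, map_one,
    map_ofNat, Complex.conj_I]
  congr 1
  rw [Finset.sum_congr rfl fun i _ => show (conj (z i) - w i) ^ 2 = (w i - conj (z i)) ^ 2 by ring]
  ring

theorem norm_rho_comm (z w : Cn n) : ‖rho z w‖ = ‖rho w z‖ := by
  rw [← rho_conj, Complex.norm_conj]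

/-- The parallelogram identity (s+t)² = 2s² + 2t² - (s-t)² for the imaginary parts. It shows that
|ρ(z,w)| dominates ρ(z), ρ(w) and the squared distance of the front coordinates at once. -/
theorem four_mul_rho_re (z w : Cn n) :
    4 * (rho z w).re = ∑ i ∈ front n, ‖z i - w i‖ ^ 2 + 2 * rhoDiag z + 2 * rhoDiag w := by
  have h : ∀ i, ((z i - conj (w i)) ^ 2).re
      = ‖z i - w i‖ ^ 2 - 2 * (z i).im ^ 2 - 2 * (w i).im ^ 2 := by
    intro i
    rw [← Complex.normSq_eq_norm_sq, Complex.normSq_apply, pow_two, Complex.mul_re]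
    simp
    ring
  have h4 : (1 / 4 : ℂ) = ((1 / 4 : ℝ) : ℂ) := by push_cast; rfl
  rw [rho, h4, Complex.re_ofReal_mul, Complex.sub_re, Complex.re_sum]
  simp only [h, Finset.sum_sub_distrib, ← Finset.mul_sum, rhoDiag]
  simp
  ring

theorem four_mul_rho_im (z w : Cn n) :
    4 * (rho z w).im = 2 * ∑ i ∈ front n, ((z i).re - (w i).re) * ((z i).im + (w i).im)
      - 2 * ((z ⊤).re - (w ⊤).re) := by
  have h : ∀ i, ((z i - conj (w i)) ^ 2).im
      = 2 * (((z i).re - (w i).re) * ((z i).im + (w i).im)) := by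
    intro i
    rw [pow_two, Complex.mul_im]
    simp
    ring
  have h4 : (1 / 4 : ℂ) = ((1 / 4 : ℝ) : ℂ) := by push_cast; rfl
  rw [rho, h4, Complex.im_ofReal_mul, Complex.sub_im, Complex.im_sum]
  simp only [h, ← Finset.mul_sum]
  simp

theorem sum_add_rhoDiag_le_norm_rho (z w : Cn n) :
    ∑ i ∈ front n, ‖z i - w i‖ ^ 2 + 2 * rhoDiag z + 2 * rhoDiag w ≤ 4 * ‖rho z w‖ := by
  rw [← four_mul_rho_re]
  gcongr
  exact Complex.re_le_norm _

theorem norm_rho_pos {z w : Cn n} (hz : z ∈ tube n) (hw : w ∈ tube n) : 0 < ‖rho z w‖ :=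
  (rho_re_pos hz hw).trans_le (Complex.re_le_norm _)

theorem rho_mem_slitPlane {z w : Cn n} (hz : z ∈ tube n) (hw : w ∈ tube n) :
    rho z w ∈ Complex.slitPlane := Or.inl (rho_re_pos hz hw)

/-- The relative size of the polydiscs `disc`. -/
noncomputable def discRadius (n : ℕ) : ℝ := 1 / (4 * (n + 1))

theorem discRadius_pos (n : ℕ) : 0 < discRadius n := by unfold discRadius; positivity

theorem discRadius_mul (n : ℕ) : discRadius n * (n + 1) = 1 / 4 := by
  unfold discRadius; field_simp

theorem discRadius_le (n : ℕ) : discRadius n ≤ 1 / 4 := by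
  nlinarith [discRadius_mul n, discRadius_pos n, n.cast_nonneg (α := ℝ)]

/-- The linear form `v_n - 2 ∑ v_j Im a_j`, the complex differential of `ρ` at `a` up to a factor. -/
def tangential (a v : Cn n) : ℂ := v ⊤ - 2 * ∑ i ∈ front n, v i * (a i).im

/-- A polydisc adapted to the geometry of the tube at `a`. -/
def disc (a : Cn n) : Set (Cn n) :=
  {w | (∀ i ∈ front n, ‖w i - a i‖ < discRadius n * √(rhoDiag a)) ∧
    ‖tangential a (w - a)‖ < discRadius n * rhoDiag a}

theorem isOpen_setOf_mem_disc : IsOpen {x : Cn n × Cn n | x.2 ∈ disc x.1} := by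
  have h : {x : Cn n × Cn n | x.2 ∈ disc x.1} =
      (⋂ i ∈ front n, {x | ‖x.2 i - x.1 i‖ < discRadius n * √(rhoDiag x.1)}) ∩
        {x | ‖tangential x.1 (x.2 - x.1)‖ < discRadius n * rhoDiag x.1} := by
    ext x; simp [disc]
  rw [h]
  refine (isOpen_biInter_finset fun i _ => isOpen_lt (by fun_prop) (by fun_prop)).inter
    (isOpen_lt ?_ (by fun_prop))
  unfold tangential
  simp only [Pi.sub_apply]
  fun_prop

theorem isOpen_disc (a : Cn n) : IsOpen (disc a) :=
  isOpen_setOf_mem_disc.preimage (Continuous.prodMk_right a)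

theorem self_mem_disc {a : Cn n} (ha : a ∈ tube n) : a ∈ disc a := by
  have := rhoDiag_pos ha
  have := discRadius_pos n
  refine ⟨fun i _ => ?_, ?_⟩
  · rw [sub_self, norm_zero]; positivity
  · simp only [tangential, sub_self, Pi.zero_apply, zero_mul, Finset.sum_const_zero, mul_zero,
      norm_zero]
    positivity

theorem card_front_le (n : ℕ) [NeZero n] : ((front n).card : ℝ) ≤ n := by
  exact_mod_cast (Finset.card_le_univ _).trans_eq (Fintype.card_fin n)

theorem sum_norm_sq_le_of_mem_disc {a w : Cn n} (ha : a ∈ tube n) (hw : w ∈ disc a) :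
    ∑ i ∈ front n, ‖w i - a i‖ ^ 2 ≤ n * discRadius n ^ 2 * rhoDiag a := by
  have hρ := rhoDiag_pos ha
  calc _ ≤ ∑ _i ∈ front n, discRadius n ^ 2 * rhoDiag a := by
        refine Finset.sum_le_sum fun i hi => ?_
        calc _ ≤ (discRadius n * √(rhoDiag a)) ^ 2 := by
              gcongr
              exact (hw.1 i hi).le
          _ = _ := by rw [mul_pow, Real.sq_sqrt hρ.le]
    _ = (front n).card * (discRadius n ^ 2 * rhoDiag a) := by
        rw [Finset.sum_const, nsmul_eq_mul]
    _ ≤ n * (discRadius n ^ 2 * rhoDiag a) := by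
        gcongr
        exact_mod_cast card_front_le n
    _ = _ := by ring

/-- The second order Taylor expansion at `a`, exact because ρ is quadratic; `tangential a` carries
the first order term. -/
theorem rhoDiag_eq_add (a w : Cn n) :
    rhoDiag w = rhoDiag a + (tangential a (w - a)).im
      - ∑ i ∈ front n, ((w i).im - (a i).im) ^ 2 := by
  have h : ∀ i, ((w i).im - (a i).im) ^ 2
      = (w i).im ^ 2 + (a i).im ^ 2 - 2 * ((w i).im * (a i).im) := fun i => by ring
  have h2 : ∀ i, ((w i).im - (a i).im) * (a i).im = (w i).im * (a i).im - (a i).im ^ 2 :=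
    fun i => by ring
  have him : (tangential a (w - a)).im = (w ⊤).im - (a ⊤).im
      - 2 * ∑ i ∈ front n, ((w i).im - (a i).im) * (a i).im := by
    have : (2 : ℂ) = ((2 : ℝ) : ℂ) := by push_cast; rfl
    rw [tangential, Complex.sub_im, this, Complex.im_ofReal_mul, Complex.im_sum]
    simp
  rw [him]
  simp only [h, h2, Finset.sum_sub_distrib, Finset.sum_add_distrib, ← Finset.mul_sum, rhoDiag]
  ring

/-- With ε the `discRadius`, the linear term of the expansion is at most ερ(a) and the quadratic one
at most nε²ρ(a) ≤ nερ(a); ε is chosen so that ε(n+1) = 1/4. -/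
theorem abs_rhoDiag_sub_le {a w : Cn n} (ha : a ∈ tube n) (hw : w ∈ disc a) :
    |rhoDiag w - rhoDiag a| ≤ rhoDiag a / 4 := by
  have hρ := rhoDiag_pos ha
  have h1 := sum_norm_sq_le_of_mem_disc ha hw
  have h2 : ∑ i ∈ front n, ((w i).im - (a i).im) ^ 2 ≤ ∑ i ∈ front n, ‖w i - a i‖ ^ 2 := by
    refine Finset.sum_le_sum fun i _ => ?_
    rw [← sq_abs, ← Complex.sub_im]
    gcongr
    exact Complex.abs_im_le_norm _
  have h3 : 0 ≤ ∑ i ∈ front n, ((w i).im - (a i).im) ^ 2 := Finset.sum_nonneg fun _ _ => sq_nonneg _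
  have h4 := abs_le.1 ((Complex.abs_im_le_norm _).trans hw.2.le)
  have h5 := discRadius_mul n
  have h6 := discRadius_le n
  have h7 := discRadius_pos n
  have h8 : n * discRadius n ^ 2 * rhoDiag a ≤ n * discRadius n * rhoDiag a := by
    have : discRadius n ^ 2 ≤ discRadius n := by nlinarith
    gcongr
  have h9 : discRadius n * rhoDiag a + n * discRadius n * rhoDiag a = rhoDiag a / 4 := by
    linear_combination rhoDiag a * h5
  rw [rhoDiag_eq_add a w, abs_le]
  constructor <;> linarith

theorem disc_subset_tube {a : Cn n} (ha : a ∈ tube n) : disc a ⊆ tube n := fun w hw => by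
  rw [mem_tube_iff]
  have := abs_le.1 (abs_rhoDiag_sub_le ha hw)
  linarith [rhoDiag_pos ha]

theorem rhoDiag_le_of_mem_disc {a w : Cn n} (ha : a ∈ tube n) (hw : w ∈ disc a) :
    rhoDiag w ≤ 2 * rhoDiag a := by
  have := abs_le.1 (abs_rhoDiag_sub_le ha hw)
  linarith [rhoDiag_pos ha]

theorem le_rhoDiag_of_mem_disc {a w : Cn n} (ha : a ∈ tube n) (hw : w ∈ disc a) :
    rhoDiag a ≤ 2 * rhoDiag w := by
  have := abs_le.1 (abs_rhoDiag_sub_le ha hw)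
  linarith [rhoDiag_pos ha]

/-- The relative oscillation of ρ(z, ·) on `disc a`, uniform in z even when z is far away. The
dangerous cross term is bounded by 2√ρ(a)·|z_i-a_i| ≤ ρ(a) + |z_i-a_i|², and both summands are
absorbed by |ρ(z,a)| through `sum_add_rhoDiag_le_norm_rho`. -/
theorem norm_rho_sub_le {a w z : Cn n} (ha : a ∈ tube n) (hw : w ∈ disc a) (hz : z ∈ tube n) :
    ‖rho z w - rho z a‖ ≤ ‖rho z a‖ / 4 := by
  have hρ := rhoDiag_pos ha
  have hε := discRadius_pos n
  -- Expansion of the polynomial ρ(z, ·) in conj(w - a); the first order terms that do not involve z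
  -- - a combine into `tangential`.
  have hid : 4 * (rho z w - rho z a) = -2 * ∑ i ∈ front n, conj (w i - a i) * (z i - a i)
      + ∑ i ∈ front n, conj (w i - a i) ^ 2 + 2 * Complex.I * conj (tangential a (w - a)) := by
    have h : ∀ i, (z i - conj (w i)) ^ 2 = (z i - conj (a i)) ^ 2
        - 2 * (conj (w i - a i) * (z i - a i)) + conj (w i - a i) ^ 2
        - 4 * Complex.I * (conj (w i - a i) * (a i).im) := by
      intro i
      have : a i - conj (a i) = 2 * (a i).im * Complex.I := by
        apply Complex.ext <;> simp
        ring
      rw [map_sub]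
      linear_combination (-2 * (conj (w i) - conj (a i))) * this
    simp only [rho, h, tangential, Finset.sum_sub_distrib, Finset.sum_add_distrib,
      ← Finset.mul_sum, map_sub, map_mul, map_sum, map_ofNat, Complex.conj_ofReal, Pi.sub_apply]
    ring
  have hle : 4 * ‖rho z w - rho z a‖ ≤ 2 * ∑ i ∈ front n, ‖w i - a i‖ * ‖z i - a i‖
      + ∑ i ∈ front n, ‖w i - a i‖ ^ 2 + 2 * ‖tangential a (w - a)‖ := by
    have h4 : 4 * ‖rho z w - rho z a‖ = ‖4 * (rho z w - rho z a)‖ := by simp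
    rw [h4, hid]
    refine (norm_add₃_le ..).trans (add_le_add (add_le_add ?_ ?_) ?_)
    · rw [norm_mul, norm_neg, Complex.norm_ofNat]
      gcongr
      refine (norm_sum_le _ _).trans_eq (Finset.sum_congr rfl fun i _ => ?_)
      rw [norm_mul, Complex.norm_conj]
    · refine (norm_sum_le _ _).trans_eq (Finset.sum_congr rfl fun i _ => ?_)
      rw [norm_pow, Complex.norm_conj]
    · simp
  have h1 := sum_norm_sq_le_of_mem_disc ha hw
  have h2 : 2 * ∑ i ∈ front n, ‖w i - a i‖ * ‖z i - a i‖
      ≤ discRadius n * (n * rhoDiag a + ∑ i ∈ front n, ‖z i - a i‖ ^ 2) := by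
    calc _ = ∑ i ∈ front n, ‖w i - a i‖ * (2 * ‖z i - a i‖) := by
          rw [Finset.mul_sum]; exact Finset.sum_congr rfl fun _ _ => by ring
      _ ≤ ∑ i ∈ front n, discRadius n * (rhoDiag a + ‖z i - a i‖ ^ 2) := by
          refine Finset.sum_le_sum fun i hi => ?_
          calc _ ≤ discRadius n * √(rhoDiag a) * (2 * ‖z i - a i‖) := by
                gcongr
                exact (hw.1 i hi).le
            _ ≤ _ := by
                rw [mul_assoc]
                gcongr
                nlinarith [sq_nonneg (√(rhoDiag a) - ‖z i - a i‖), Real.sq_sqrt hρ.le]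
      _ = discRadius n * ((front n).card * rhoDiag a + ∑ i ∈ front n, ‖z i - a i‖ ^ 2) := by
          rw [← Finset.mul_sum, Finset.sum_add_distrib, Finset.sum_const, nsmul_eq_mul]
      _ ≤ _ := by
          gcongr
          exact_mod_cast card_front_le n
  have h3 := sum_add_rhoDiag_le_norm_rho z a
  have h8 : n * discRadius n ^ 2 * rhoDiag a ≤ n * discRadius n * rhoDiag a := by
    have : discRadius n ^ 2 ≤ discRadius n := by nlinarith [discRadius_le n]
    gcongr
  set S := ∑ i ∈ front n, ‖z i - a i‖ ^ 2
  have hS : 0 ≤ S := Finset.sum_nonneg fun _ _ => sq_nonneg _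
  have h9 : discRadius n * (n + 1) * (2 * rhoDiag a) = 1 / 4 * (2 * rhoDiag a) := by
    rw [discRadius_mul]
  have h10 : discRadius n * S ≤ 1 / 4 * S := by gcongr; exact discRadius_le n
  have := rhoDiag_pos hz
  linarith [hw.2]

theorem norm_rho_le_of_mem_disc {a w z : Cn n} (ha : a ∈ tube n) (hw : w ∈ disc a)
    (hz : z ∈ tube n) : ‖rho z w‖ ≤ 2 * ‖rho z a‖ := by
  have := norm_rho_sub_le ha hw hz
  have h2 := norm_le_norm_add_norm_sub' (rho z w) (rho z a)
  linarith [norm_nonneg (rho z a)]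

theorem le_norm_rho_of_mem_disc {a w z : Cn n} (ha : a ∈ tube n) (hw : w ∈ disc a)
    (hz : z ∈ tube n) : ‖rho z a‖ ≤ 2 * ‖rho z w‖ := by
  have := norm_rho_sub_le ha hw hz
  have h2 := norm_le_norm_add_norm_sub (rho z w) (rho z a)
  linarith [norm_nonneg (rho z a)]

/-- The oscillation bound with first argument `a` itself: for a in the polydisc of w, ρ(a,w) has at
most the size of ρ(a,a). -/
theorem norm_rho_le_mul_rhoDiag {a w : Cn n} (hw : w ∈ tube n) (ha : a ∈ disc w) :
    ‖rho a w‖ ≤ 2 * rhoDiag a := by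
  have hat := disc_subset_tube hw ha
  have := le_norm_rho_of_mem_disc hw ha hat
  rwa [rho_self, Complex.norm_real, Real.norm_of_nonneg (rhoDiag_pos hat).le] at this

end Geometry

theorem measurable_indicator_of_continuousOn {α β : Type*} [TopologicalSpace α]
    [MeasurableSpace α] [OpensMeasurableSpace α] [TopologicalSpace β] [MeasurableSpace β]
    [BorelSpace β] [Zero β] {f : α → β} {s : Set α} (hs : MeasurableSet s)
    (hf : ContinuousOn f s) : Measurable (s.indicator f) := by
  classical
  rw [← Set.piecewise_eq_indicator]
  exact hf.measurable_piecewise continuous_zero.continuousOn hs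

/-! ### Mean value inequality on the polydiscs, and their volume. -/

section SubMean
variable {n : ℕ} [NeZero n]

theorem enorm_rpow_le_lintegral_circle {h : ℂ → ℂ}
    (hh : AnalyticOnNhd ℂ h (Metric.closedBall 0 1)) {p : ℝ} (hp : 0 < p) :
    ‖h 0‖ₑ ^ p ≤ ENNReal.ofReal (2 * Real.pi)⁻¹ *
      ∫⁻ θ in Set.Ioc 0 (2 * Real.pi), ‖h (circleMap 0 1 θ)‖ₑ ^ p := by
  have h1 := rpow_norm_le_circleAverage hh hp
  have hint := circleIntegrable_rpow_norm hh hp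
  rw [Real.circleAverage_def, intervalIntegral.integral_of_le (by positivity), smul_eq_mul] at h1
  have h2 : ∀ x : ℂ, ENNReal.ofReal (‖x‖ ^ p) = ‖x‖ₑ ^ p := fun x => by
    rw [← ENNReal.ofReal_rpow_of_nonneg (norm_nonneg _) hp.le, ofReal_norm]
  have h3 := ENNReal.ofReal_le_ofReal h1
  rw [ENNReal.ofReal_mul (by positivity), ofReal_integral_eq_lintegral_ofReal
    ((intervalIntegrable_iff_integrableOn_Ioc_of_le (by positivity)).1 hint)
    (.of_forall fun _ => by positivity)] at h3
  simpa only [h2] using h3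

theorem measurePreserving_smul_of_norm_eq_one {ι : Type*} [Fintype ι] {u : ℂ} (hu : ‖u‖ = 1) :
    MeasurePreserving (fun v : ι → ℂ => u • v) := by
  have h1 : MeasurePreserving (fun z : ℂ => u * z) := by
    have := (rotation ⟨u, mem_sphere_zero_iff_norm.2 hu⟩).measurePreserving
    exact this
  exact volume_preserving_pi (fun _ : ι => h1)

/-- The translate `disc a - a` is balanced, so the closed complex discs centred at `a` through its
points stay inside; the one-variable mean value property applies along them. -/
theorem add_smul_mem_disc {a v : Cn n} (hv : a + v ∈ disc a) {c : ℂ} (hc : ‖c‖ ≤ 1) :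
    a + c • v ∈ disc a := by
  have ht : tangential a (c • v) = c * tangential a v := by
    simp only [tangential, Pi.smul_apply, smul_eq_mul, mul_sub, Finset.mul_sum]
    congr 1
    exact Finset.sum_congr rfl fun i _ => by ring
  have hle : ∀ x : ℂ, ‖c * x‖ ≤ ‖x‖ := fun x => by
    rw [norm_mul]
    exact mul_le_of_le_one_left (norm_nonneg _) hc
  obtain ⟨h1, h2⟩ := hv
  simp only [Pi.add_apply, add_sub_cancel_left] at h1 h2
  refine ⟨fun i hi => ?_, ?_⟩
  · simpa using (hle _).trans_lt (h1 i hi)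
  · rw [add_sub_cancel_left, ht]
    exact (hle _).trans_lt h2

/-- The sub-mean value property of `|f|^p` on the polydiscs `disc`, for all `p > 0`. -/
theorem enorm_rpow_mul_volume_disc_le {f : Cn n → ℂ} (hf : DifferentiableOn ℂ f (tube n))
    {a : Cn n} (ha : a ∈ tube n) {p : ℝ} (hp : 0 < p) :
    ‖f a‖ₑ ^ p * volume (disc a) ≤ ∫⁻ w in disc a, ‖f w‖ₑ ^ p := by
  have hsub := disc_subset_tube ha
  set H : Cn n → ℝ≥0∞ := (disc a).indicator fun w => ‖f w‖ₑ ^ p with hH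
  have hHm : Measurable H := by
    have hc : ContinuousOn (fun w => ‖f w‖ₑ ^ p) (disc a) := by
      have := (hf.continuousOn.mono hsub).enorm
      exact (ENNReal.continuous_rpow_const (y := p)).comp_continuousOn this
    exact measurable_indicator_of_continuousOn (isOpen_disc a).measurableSet hc
  have hmean : ∀ v, a + v ∈ disc a → ‖f a‖ₑ ^ p ≤ ENNReal.ofReal (2 * Real.pi)⁻¹ *
      ∫⁻ θ in Set.Ioc 0 (2 * Real.pi), H (a + circleMap 0 1 θ • v) := by
    intro v hv
    have han : AnalyticOnNhd ℂ (fun c : ℂ => f (a + c • v)) (Metric.closedBall 0 1) := by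
      have hU : IsOpen ((fun c : ℂ => a + c • v) ⁻¹' tube n) :=
        isOpen_tube.preimage (by fun_prop)
      have hd : DifferentiableOn ℂ (fun c : ℂ => f (a + c • v))
          ((fun c : ℂ => a + c • v) ⁻¹' tube n) :=
        hf.comp (by fun_prop) (Set.mapsTo_preimage _ _)
      exact (hd.analyticOnNhd hU).mono fun c hc =>
        hsub (add_smul_mem_disc hv (by simpa using hc))
    have := enorm_rpow_le_lintegral_circle han hp
    simp only [zero_smul, add_zero] at this
    refine this.trans_eq ?_
    congr 1
    refine lintegral_congr fun θ => ?_
    rw [hH, Set.indicator_of_mem (add_smul_mem_disc hv (by simp))]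
  -- Multiplication by e^{iθ} preserves Lebesgue measure, so averaging over all complex lines
  -- through `a` gives back the integral over the polydisc.
  have hrot : ∀ θ : ℝ, ∫⁻ v, H (a + circleMap 0 1 θ • v) = ∫⁻ w, H w := fun θ => by
    rw [(measurePreserving_smul_of_norm_eq_one (u := circleMap 0 1 θ) (by simp)).lintegral_comp
      (f := fun v => H (a + v)) (by fun_prop), lintegral_add_left_eq_self]
  calc ‖f a‖ₑ ^ p * volume (disc a)
      = ∫⁻ w, (disc a).indicator (fun _ => ‖f a‖ₑ ^ p) w := by
        rw [lintegral_indicator (isOpen_disc a).measurableSet, setLIntegral_const]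
    _ = ∫⁻ v, (disc a).indicator (fun _ => ‖f a‖ₑ ^ p) (a + v) :=
        (lintegral_add_left_eq_self _ a).symm
    _ ≤ ∫⁻ v, ENNReal.ofReal (2 * Real.pi)⁻¹ *
        ∫⁻ θ in Set.Ioc 0 (2 * Real.pi), H (a + circleMap 0 1 θ • v) := by
        refine lintegral_mono fun v => ?_
        by_cases hv : a + v ∈ disc a
        · simpa only [Set.indicator_of_mem hv] using hmean v hv
        · simp [Set.indicator_of_notMem hv]
    _ = ENNReal.ofReal (2 * Real.pi)⁻¹ * ∫⁻ θ in Set.Ioc 0 (2 * Real.pi),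
        ∫⁻ v, H (a + circleMap 0 1 θ • v) := by
        have hmeas : Measurable fun x : Cn n × ℝ => H (a + circleMap 0 1 x.2 • x.1) := by
          refine hHm.comp ?_
          have : Continuous fun x : Cn n × ℝ => a + circleMap 0 1 x.2 • x.1 := by fun_prop
          exact this.measurable
        rw [lintegral_const_mul _ hmeas.lintegral_prod_right', lintegral_lintegral_swap
          hmeas.aemeasurable]
    _ = ∫⁻ w, H w := by
        simp only [hrot, setLIntegral_const, Real.volume_Ioc, sub_zero]
        rw [mul_comm (∫⁻ w, H w), ← mul_assoc, ← ENNReal.ofReal_mul (by positivity),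
          inv_mul_cancel₀ (by positivity), ENNReal.ofReal_one, one_mul]
    _ = _ := lintegral_indicator (isOpen_disc a).measurableSet _

/-- A shear in the last coordinate straightens `tangential`, and the polydisc becomes a product of
n-1 plane discs of radius ε√ρ(a) and one of radius ερ(a). The areas multiply to a multiple of
ρ(a)^(n-1)·ρ(a)², which is the origin of the exponent n+1. -/
theorem volume_disc {a : Cn n} (ha : a ∈ tube n) :
    volume (disc a) = ENNReal.ofReal ((discRadius n ^ 2 * Real.pi) ^ n) *
      ENNReal.ofReal (rhoDiag a) ^ ((n : ℝ) + 1) := by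
  have hρ := rhoDiag_pos ha
  have hε := discRadius_pos n
  have hφm : Measurable fun w : Cn n => 2 * ∑ i ∈ front n, w i * ((a i).im : ℂ) := by fun_prop
  have hφ : ∀ (w : Cn n) ζ, 2 * ∑ i ∈ front n, Function.update w ⊤ ζ i * ((a i).im : ℂ)
      = 2 * ∑ i ∈ front n, w i * ((a i).im : ℂ) := fun w ζ => by
    congr 1
    exact Finset.sum_congr rfl fun i hi => by
      rw [Function.update_of_ne (Finset.ne_of_mem_erase hi)]
  have hS := measurePreserving_shear ⊤ hφm hφ
  set r : Fin n → ℝ := fun i =>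
    if i = ⊤ then discRadius n * rhoDiag a else discRadius n * √(rhoDiag a) with hr
  have hpre : (fun w : Cn n => a + Function.update w ⊤ (w ⊤ + 2 * ∑ i ∈ front n,
      w i * ((a i).im : ℂ))) ⁻¹' disc a = Set.pi Set.univ fun i => Metric.ball 0 (r i) := by
    ext w
    have ht : tangential a (Function.update w ⊤ (w ⊤ + 2 * ∑ i ∈ front n,
        w i * ((a i).im : ℂ))) = w ⊤ := by
      rw [tangential, hφ, Function.update_self, add_sub_cancel_right]
    simp only [disc, Set.mem_preimage, Set.mem_ofPred_eq, Set.mem_pi, Set.mem_univ, true_implies,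
      add_sub_cancel_left, ht, Pi.add_apply, mem_ball_zero_iff, hr]
    constructor
    · rintro ⟨h1, h2⟩ i
      by_cases hi : i = ⊤
      · subst hi; simpa using h2
      · simpa [hi, Function.update_of_ne hi] using h1 i (by simp [hi])
    · intro h
      refine ⟨fun i hi => ?_, by simpa using h ⊤⟩
      have hi' := Finset.ne_of_mem_erase hi
      simpa [hi', Function.update_of_ne hi'] using h i
  have hmp := (measurePreserving_add_left volume a).comp hS
  have hvol := hmp.measure_preimage (isOpen_disc a).measurableSet.nullMeasurableSet
  rw [← hvol]
  simp only [Function.comp_def]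
  rw [hpre, volume_pi_pi]
  have hball : ∀ i, volume (Metric.ball (0 : ℂ) (r i)) = ENNReal.ofReal (r i ^ 2 * Real.pi) := by
    intro i
    have : 0 ≤ r i := by rw [hr]; dsimp only; split_ifs <;> positivity
    rw [Complex.volume_ball, ENNReal.ofReal_mul (by positivity), ENNReal.ofReal_pow this]
    congr 1
    rw [← ENNReal.ofReal_coe_nnreal, NNReal.coe_real_pi]
  simp only [hball]
  rw [← ENNReal.ofReal_prod_of_nonneg (fun i _ => by positivity),
    ENNReal.ofReal_rpow_of_pos hρ, ← ENNReal.ofReal_mul (by positivity)]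
  congr 1
  rw [← Finset.mul_prod_erase _ _ (Finset.mem_univ (⊤ : Fin n)),
    Finset.prod_congr rfl (g := fun _ => discRadius n ^ 2 * Real.pi * rhoDiag a) fun i hi => by
      rw [hr]
      simp only [Finset.ne_of_mem_erase hi, if_false, mul_pow, Real.sq_sqrt hρ.le]
      ring,
    Finset.prod_const, Finset.card_erase_of_mem (Finset.mem_univ _), Finset.card_univ,
    Fintype.card_fin]
  obtain ⟨m, hm⟩ := Nat.exists_eq_succ_of_ne_zero (NeZero.ne n)
  have h1 : rhoDiag a ^ ((n : ℝ) + 1) = rhoDiag a ^ (m + 2) := by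
    have : (n : ℝ) = m + 1 := by exact_mod_cast hm
    rw [← Real.rpow_natCast, this]; push_cast; ring_nf
  have h2 : (discRadius n ^ 2 * Real.pi) ^ n = (discRadius n ^ 2 * Real.pi) ^ (m + 1) := by
    rw [← Nat.succ_eq_add_one, ← hm]
  rw [h1, h2, show n - 1 = m by omega]
  simp only [hr, if_true]
  ring

end SubMean
-- The Forelli–Rudin integral estimate.
section ForelliRudin

/-- The one-dimensional integral behind the front coordinates. -/
theorem exists_lintegral_front_kernel {s : ℝ} (hs : 1 < s) : ∃ C : ℝ≥0, ∀ r : ℝ, 0 < r → ∀ c : ℂ,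
    ∫⁻ ζ : ℂ, ENNReal.ofReal ((r + ‖c - ζ‖ ^ 2) ^ (-s)) = C * ENNReal.ofReal (r ^ (1 - s)) := by
  have hfin : ∫⁻ ζ : ℂ, ENNReal.ofReal ((1 + ‖ζ‖ ^ 2) ^ (-s)) < ∞ := by
    have := integrable_rpow_neg_one_add_norm_sq (E := ℂ) (μ := volume) (r := 2 * s)
      (by rw [Complex.finrank_real_complex]; push_cast; linarith)
    rw [show -(2 * s) / 2 = -s by ring] at this
    exact this.lintegral_lt_top
  refine ⟨(∫⁻ ζ : ℂ, ENNReal.ofReal ((1 + ‖ζ‖ ^ 2) ^ (-s))).toNNReal, fun r hr c => ?_⟩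
  rw [ENNReal.coe_toNNReal hfin.ne, lintegral_sub_left_eq_self
    (fun ζ : ℂ => ENNReal.ofReal ((r + ‖ζ‖ ^ 2) ^ (-s))) c]
  have hsq : 0 < √r := Real.sqrt_pos.2 hr
  have hscale : ∀ ζ : ℂ, ENNReal.ofReal ((r + ‖ζ‖ ^ 2) ^ (-s)) =
      ENNReal.ofReal (r ^ (-s)) * ENNReal.ofReal ((1 + ‖(√r)⁻¹ • ζ‖ ^ 2) ^ (-s)) := fun ζ => by
    rw [← ENNReal.ofReal_mul (by positivity), ← Real.mul_rpow hr.le (by positivity), norm_smul,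
      Real.norm_of_nonneg (by positivity), mul_pow, inv_pow, Real.sq_sqrt hr.le]
    congr 2
    field_simp
  simp only [hscale]
  rw [lintegral_const_mul _ (by fun_prop), lintegral_comp_real_smul volume
    (fun ζ : ℂ => ENNReal.ofReal ((1 + ‖ζ‖ ^ 2) ^ (-s))) (by fun_prop) (by positivity),
    Complex.finrank_real_complex, inv_pow, inv_inv, Real.sq_sqrt hr.le, abs_of_pos hr, ← mul_assoc,
    ← ENNReal.ofReal_mul (by positivity), mul_comm]
  congr 2
  rw [Real.rpow_sub hr, Real.rpow_one, Real.rpow_neg hr.le]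
  field_simp

/-- The kernel in the last coordinate. -/
noncomputable def lastKernel (α s t r : ℝ) (ζ : ℂ) : ℝ≥0∞ :=
  {ζ : ℂ | 0 < ζ.im}.indicator
    (fun ζ => ENNReal.ofReal (ζ.im ^ α * (r + ζ.im) ^ (-s) * (r + |ζ.re|) ^ (-t))) ζ

theorem measurable_lastKernel (α s t r : ℝ) : Measurable (lastKernel α s t r) := by
  unfold lastKernel
  exact Measurable.indicator (by fun_prop)
    (measurableSet_lt measurable_const Complex.measurable_im)

/-- The integral factors over real and imaginary parts. In y, the condition -1 < α gives convergence
at 0 and α - s < -1 at infinity; in x, t > 1 suffices. -/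
theorem lintegral_lastKernel_one_lt_top {α s t : ℝ} (hα : -1 < α) (hs : α + 1 < s) (ht : 1 < t) :
    ∫⁻ ζ, lastKernel α s t 1 ζ < ∞ := by
  have h1 : IntegrableOn (fun y : ℝ => y ^ α * (1 + y) ^ (-s)) (Set.Ioi 0) := by
    have hmeas : Measurable fun y : ℝ => y ^ α * (1 + y) ^ (-s) := by fun_prop
    rw [← Set.Ioc_union_Ioi_eq_Ioi zero_le_one]
    refine IntegrableOn.union ?_ ?_
    · have h2 : IntegrableOn (fun y : ℝ => y ^ α) (Set.Ioc 0 1) :=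
        (intervalIntegrable_iff_integrableOn_Ioc_of_le zero_le_one).1
          (intervalIntegral.intervalIntegrable_rpow' hα)
      refine h2.mono' hmeas.aestronglyMeasurable ?_
      refine (ae_restrict_mem measurableSet_Ioc).mono fun y hy => ?_
      have hy0 : 0 < y := hy.1
      rw [Real.norm_of_nonneg (by positivity)]
      exact mul_le_of_le_one_right (by positivity)
        (Real.rpow_le_one_of_one_le_of_nonpos (by linarith) (by linarith))
    · have h2 : IntegrableOn (fun y : ℝ => y ^ (α - s)) (Set.Ioi 1) :=
        integrableOn_Ioi_rpow_of_lt (by linarith) one_pos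
      refine h2.mono' hmeas.aestronglyMeasurable ?_
      refine (ae_restrict_mem measurableSet_Ioi).mono fun y hy => ?_
      have hy0 : 0 < y := one_pos.trans hy
      rw [Real.norm_of_nonneg (by positivity), sub_eq_add_neg, Real.rpow_add hy0]
      gcongr ?_ * ?_
      exact Real.rpow_le_rpow_of_nonpos hy0 (by linarith) (by linarith)
  have h2 : Integrable fun x : ℝ => (1 + |x|) ^ (-t) :=
    integrable_one_add_norm (E := ℝ) (by simpa using ht)
  have h3 := h2.mul_prod ((integrable_indicator_iff measurableSet_Ioi).2 h1)
  have h4 := h3.lintegral_lt_top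
  refine lt_of_le_of_lt (le_of_eq ?_) h4
  rw [← Measure.volume_eq_prod, ← Complex.volume_preserving_equiv_real_prod.lintegral_comp (by
    refine ENNReal.measurable_ofReal.comp (Measurable.mul (by fun_prop) ?_)
    exact Measurable.comp (Measurable.indicator (by fun_prop) measurableSet_Ioi) measurable_snd)]
  refine lintegral_congr fun ζ => ?_
  simp only [lastKernel, Complex.measurableEquivRealProd_apply, Set.indicator_apply,
    Set.mem_ofPred_eq, Set.mem_Ioi]
  split_ifs
  · congr 1; ring
  · simp

theorem lastKernel_scale {α s t r : ℝ} (hr : 0 < r) (ζ : ℂ) :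
    lastKernel α s t r ζ = ENNReal.ofReal (r ^ (α - s - t)) * lastKernel α s t 1 (r⁻¹ • ζ) := by
  simp only [lastKernel, Set.indicator_apply, Set.mem_ofPred_eq, Complex.smul_im, Complex.smul_re,
    smul_eq_mul]
  have hiff : 0 < r⁻¹ * ζ.im ↔ 0 < ζ.im := by simp [hr]
  simp only [hiff]
  split_ifs with h
  · rw [← ENNReal.ofReal_mul (by positivity)]
    congr 1
    have e1 : r + ζ.im = r * (1 + r⁻¹ * ζ.im) := by field_simp
    have e2 : r + |ζ.re| = r * (1 + |r⁻¹ * ζ.re|) := by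
      rw [abs_mul, abs_of_pos (inv_pos.2 hr)]; field_simp
    have e3 : ζ.im ^ α = r ^ α * (r⁻¹ * ζ.im) ^ α := by
      rw [← Real.mul_rpow hr.le (by positivity)]; congr 1; field_simp
    rw [e1, e2, e3, Real.mul_rpow hr.le (by positivity), Real.mul_rpow hr.le (by positivity),
      sub_eq_add_neg, sub_eq_add_neg, Real.rpow_add hr, Real.rpow_add hr]
    ring
  · simp

theorem exists_lintegral_lastKernel {α s t : ℝ} (hα : -1 < α) (hs : α + 1 < s) (ht : 1 < t) :
    ∃ C : ℝ≥0, ∀ r : ℝ, 0 < r →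
      ∫⁻ ζ, lastKernel α s t r ζ = C * ENNReal.ofReal (r ^ (2 + α - s - t)) := by
  refine ⟨(∫⁻ ζ, lastKernel α s t 1 ζ).toNNReal, fun r hr => ?_⟩
  rw [ENNReal.coe_toNNReal (lintegral_lastKernel_one_lt_top hα hs ht).ne]
  simp only [lastKernel_scale hr]
  have hm := measurable_lastKernel α s t 1
  rw [lintegral_const_mul _ (by fun_prop), lintegral_comp_real_smul volume _ hm (by positivity),
    Complex.finrank_real_complex, inv_pow, inv_inv, abs_of_pos (by positivity), ← mul_assoc,
    ← ENNReal.ofReal_mul (by positivity), mul_comm]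
  congr 2
  rw [show 2 + α - s - t = (α - s - t) + (2 : ℕ) by push_cast; ring, Real.rpow_add hr,
    Real.rpow_natCast]

variable {n : ℕ} [NeZero n]

/-- The change of variables which flattens the tube and straightens `ρ(z, ·)`. -/
noncomputable def flattenShift (z w : Cn n) : ℂ :=
  (((z ⊤).re - ∑ i ∈ front n, ((z i).re - (w i).re) * ((z i).im + (w i).im) : ℝ) : ℂ) +
    ((∑ i ∈ front n, (w i).im ^ 2 : ℝ) : ℂ) * Complex.I

theorem flattenShift_update (z w : Cn n) (ζ : ℂ) :
    flattenShift z (Function.update w ⊤ ζ) = flattenShift z w := by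
  have h : ∀ g : Fin n → ℂ → ℝ,
      ∑ i ∈ front n, g i (Function.update w ⊤ ζ i) = ∑ i ∈ front n, g i (w i) := fun g =>
    Finset.sum_congr rfl fun i hi => by rw [Function.update_of_ne (Finset.ne_of_mem_erase hi)]
  have h1 := h fun i u => ((z i).re - u.re) * ((z i).im + u.im)
  have h2 := h fun _ u => u.im ^ 2
  simp only [flattenShift, h1, h2]

theorem flattenShift_re (z w : Cn n) : (flattenShift z w).re =
    (z ⊤).re - ∑ i ∈ front n, ((z i).re - (w i).re) * ((z i).im + (w i).im) := by
  have : ∀ a b : ℝ, ((a : ℂ) + b * Complex.I).re = a := by simp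
  exact this _ _

theorem flattenShift_im (z w : Cn n) :
    (flattenShift z w).im = ∑ i ∈ front n, (w i).im ^ 2 := by
  have : ∀ a b : ℝ, ((a : ℂ) + b * Complex.I).im = b := by simp
  exact this _ _

/-- The inverse of the change of variables flattening the tube. -/
noncomputable def flatten (z w : Cn n) : Cn n := Function.update w ⊤ (w ⊤ + flattenShift z w)

theorem measurePreserving_flatten (z : Cn n) : MeasurePreserving (flatten z) :=
  measurePreserving_shear ⊤ (by unfold flattenShift; fun_prop) (flattenShift_update z)

theorem flatten_front (z w : Cn n) {i : Fin n} (hi : i ∈ front n) : flatten z w i = w i :=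
  Function.update_of_ne (Finset.ne_of_mem_erase hi) ..

theorem rhoDiag_flatten (z w : Cn n) : rhoDiag (flatten z w) = (w ⊤).im := by
  rw [rhoDiag, Finset.sum_congr rfl fun i hi => by rw [flatten_front z w hi]]
  rw [flatten, Function.update_self, Complex.add_im, flattenShift_im, add_sub_cancel_right]

theorem four_mul_rho_flatten_im (z w : Cn n) :
    4 * (rho z (flatten z w)).im = 2 * (w ⊤).re := by
  rw [four_mul_rho_im, Finset.sum_congr rfl fun i hi => by rw [flatten_front z w hi]]
  rw [flatten, Function.update_self, Complex.add_re, flattenShift_re]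
  ring

/-- In the flattened coordinates 4|ρ(z,w)| is at least each of ρ(z)+|z_i-w_i|², ρ(z)+Im w_n and
ρ(z)+|Re w_n|. Splitting the exponent among these bounds turns the kernel into a product of
functions of one variable. -/
theorem rpow_neg_norm_rho_flatten_le {z w : Cn n} (hz : z ∈ tube n) (hw : 0 < (w ⊤).im)
    {s₁ s₂ s₃ : ℝ} (h₁ : 0 < s₁) (h₂ : 0 < s₂) (h₃ : 0 < s₃) :
    (4 * ‖rho z (flatten z w)‖) ^ (-((front n).card * s₁ + s₂ + s₃)) ≤
      (∏ i ∈ front n, (rhoDiag z + ‖z i - w i‖ ^ 2) ^ (-s₁)) *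
        ((rhoDiag z + (w ⊤).im) ^ (-s₂) * (rhoDiag z + |(w ⊤).re|) ^ (-s₃)) := by
  have hr := rhoDiag_pos hz
  have hle := sum_add_rhoDiag_le_norm_rho z (flatten z w)
  rw [rhoDiag_flatten, Finset.sum_congr rfl fun i hi => by rw [flatten_front z w hi]] at hle
  have hS : 0 ≤ ∑ i ∈ front n, ‖z i - w i‖ ^ 2 := Finset.sum_nonneg fun _ _ => sq_nonneg _
  have him : 2 * |(w ⊤).re| ≤ 4 * ‖rho z (flatten z w)‖ := by
    have := Complex.abs_im_le_norm (rho z (flatten z w))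
    have h4 := four_mul_rho_flatten_im z w
    have h5 : 4 * |(rho z (flatten z w)).im| = 2 * |(w ⊤).re| := by
      rw [← abs_two (α := ℝ), ← abs_mul, ← h4, abs_mul, abs_of_pos (four_pos : (0 : ℝ) < 4)]
    linarith
  set R := 4 * ‖rho z (flatten z w)‖
  have hR : 0 < R := by linarith
  rw [neg_add, neg_add, Real.rpow_add hR, Real.rpow_add hR, ← mul_assoc]
  gcongr ?_ * ?_ * ?_
  · rw [← mul_neg, mul_comm, Real.rpow_mul hR.le, Real.rpow_natCast, ← Finset.prod_const]
    refine Finset.prod_le_prod (fun _ _ => by positivity) fun i hi => ?_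
    refine Real.rpow_le_rpow_of_nonpos (by positivity) ?_ (by linarith)
    have := Finset.single_le_sum (f := fun i => ‖z i - w i‖ ^ 2) (fun _ _ => sq_nonneg _) hi
    linarith
  · exact Real.rpow_le_rpow_of_nonpos (by positivity) (by linarith) (by linarith)
  · exact Real.rpow_le_rpow_of_nonpos (by positivity) (by linarith) (by linarith)

theorem card_front (n : ℕ) [NeZero n] : ((front n).card : ℝ) = n - 1 := by
  rw [Finset.card_erase_of_mem (Finset.mem_univ _), Finset.card_univ, Fintype.card_fin,
    Nat.cast_pred (NeZero.pos n)]

theorem measurable_weight : Measurable fun w : Cn n => ENNReal.ofReal (rhoDiag w) :=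
  ENNReal.measurable_ofReal.comp continuous_rhoDiag.measurable

theorem measurable_enorm_rho : Measurable fun x : Cn n × Cn n => ‖rho x.1 x.2‖ₑ :=
  continuous_rho.measurable.enorm

theorem measurable_enorm_rho_right (z : Cn n) : Measurable fun w : Cn n => ‖rho z w‖ₑ := by
  have h := (measurable_enorm_rho (n := n)).comp (measurable_prodMk_left (x := z))
  exact h

/-- The **Forelli–Rudin estimate** for the kernel `|ρ(z, w)|⁻ˢ`. -/
theorem exists_lintegral_rho_le {α s : ℝ} (hα : -1 < α) (hs : n + 1 + α < s) :
    ∃ C : ℝ≥0, 0 < C ∧ ∀ z ∈ tube n,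
      ∫⁻ w in tube n, ENNReal.ofReal (rhoDiag w) ^ α * ‖rho z w‖ₑ ^ (-s)
        ≤ C * ENNReal.ofReal (rhoDiag z) ^ (n + 1 + α - s) := by
  -- The surplus s - (n+1+α) is shared equally among the n+1 factors: n-1 front coordinates and the
  -- imaginary and real parts of the last one. Each of these integrals is critical at η = 0.
  set η : ℝ := (s - (n + 1 + α)) / (n + 1) with hη
  have hηpos : 0 < η := div_pos (by linarith) (by positivity)
  have hηs : (n + 1) * η = s - (n + 1 + α) := by rw [hη]; field_simp
  obtain ⟨C₁, hC₁⟩ := exists_lintegral_front_kernel (s := 1 + η) (by linarith)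
  obtain ⟨C₂, hC₂⟩ := exists_lintegral_lastKernel (s := α + 1 + η) (t := 1 + η) hα
    (by linarith) (by linarith)
  -- The summand 1 only makes the constant visibly positive.
  refine ⟨Real.toNNReal (4 ^ s) * (C₂ * C₁ ^ (front n).card) + 1, by positivity, fun z hz => ?_⟩
  have hr := rhoDiag_pos hz
  have hsum : (front n).card * (1 + η) + (α + 1 + η) + (1 + η) = s := by
    rw [card_front]; linear_combination hηs
  set k : Fin n → ℂ → ℝ≥0∞ := fun i ζ =>
    if i = ⊤ then lastKernel α (α + 1 + η) (1 + η) (rhoDiag z) ζ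
    else ENNReal.ofReal ((rhoDiag z + ‖z i - ζ‖ ^ 2) ^ (-(1 + η))) with hk
  have hkm : ∀ i, Measurable (k i) := fun i => by
    simp only [hk]
    split_ifs
    · exact measurable_lastKernel ..
    · fun_prop
  have hprod : ∀ F : Fin n → ℝ≥0∞, ∏ i, F i = F ⊤ * ∏ i ∈ front n, F i := fun F =>
    (Finset.mul_prod_erase _ _ (Finset.mem_univ (⊤ : Fin n))).symm
  have hpt : ∀ w, (tube n).indicator (fun w => ENNReal.ofReal (rhoDiag w) ^ α * ‖rho z w‖ₑ ^ (-s))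
      (flatten z w) ≤ ENNReal.ofReal (4 ^ s) * ∏ i, k i (w i) := fun w => by
    by_cases hw : flatten z w ∈ tube n
    swap
    · simp [Set.indicator_of_notMem hw]
    rw [Set.indicator_of_mem hw]
    have hpos := norm_rho_pos hz hw
    rw [mem_tube_iff, rhoDiag_flatten] at hw
    rw [rhoDiag_flatten, hprod]
    simp only [hk, if_true]
    rw [Finset.prod_congr rfl fun i hi => if_neg (Finset.ne_of_mem_erase hi),
      ← ENNReal.ofReal_prod_of_nonneg fun _ _ => by positivity, lastKernel,
      Set.indicator_of_mem (show w ⊤ ∈ {ζ : ℂ | 0 < ζ.im} from hw), ← ofReal_norm,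
      ENNReal.ofReal_rpow_of_pos hw, ENNReal.ofReal_rpow_of_pos hpos,
      ← ENNReal.ofReal_mul (by positivity), ← ENNReal.ofReal_mul (by positivity),
      ← ENNReal.ofReal_mul (by positivity)]
    refine ENNReal.ofReal_le_ofReal ?_
    have := rpow_neg_norm_rho_flatten_le hz hw (s₁ := 1 + η) (s₂ := α + 1 + η) (s₃ := 1 + η)
      (by linarith) (by linarith) (by linarith)
    rw [hsum, Real.mul_rpow (by positivity) hpos.le] at this
    have h4 : (4 : ℝ) ^ s * 4 ^ (-s) = 1 := by
      rw [← Real.rpow_add (by positivity), add_neg_cancel, Real.rpow_zero]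
    refine le_of_eq_of_le ?_ ((mul_le_mul_of_nonneg_left this
      (show 0 ≤ (w ⊤).im ^ α * 4 ^ s by positivity)).trans_eq ?_)
    · rw [mul_assoc, ← mul_assoc (4 ^ s : ℝ), h4, one_mul]
    · ring
  have hmeas : Measurable ((tube n).indicator fun w : Cn n =>
      ENNReal.ofReal (rhoDiag w) ^ α * ‖rho z w‖ₑ ^ (-s)) := by
    exact ((measurable_weight.pow_const α).mul
      ((measurable_enorm_rho_right z).pow_const (-s))).indicator measurableSet_tube
  rw [← lintegral_indicator measurableSet_tube,
    ← (measurePreserving_flatten z).lintegral_comp hmeas]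
  refine (lintegral_mono fun w => hpt w).trans ?_
  clear_value k
  calc ∫⁻ w : Cn n, ENNReal.ofReal (4 ^ s) * ∏ i, k i (w i)
      = ENNReal.ofReal (4 ^ s) * ∏ i, ∫⁻ ζ, k i ζ := by
        rw [lintegral_const_mul _ (f := fun w : Fin n → ℂ => ∏ i, k i (w i))
          (Finset.measurable_fun_prod _ fun i _ => (hkm i).comp (measurable_pi_apply i)), lintegral_fin_prod k hkm]
    _ = ENNReal.ofReal (4 ^ s) * (C₂ * C₁ ^ (front n).card) *
        ENNReal.ofReal (rhoDiag z) ^ (n + 1 + α - s) := by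
        rw [hprod, Finset.prod_congr rfl (g := fun _ => C₁ * ENNReal.ofReal (rhoDiag z ^ (-η)))
          fun i hi => by
            simp only [hk, if_neg (Finset.ne_of_mem_erase hi)]
            rw [hC₁ _ hr, sub_add_cancel_left],
          Finset.prod_const]
        simp only [hk, if_true]
        rw [hC₂ _ hr, mul_pow, mul_assoc, ← ENNReal.ofReal_pow (by positivity)]
        have : rhoDiag z ^ (n + 1 + α - s) = rhoDiag z ^ (2 + α - (α + 1 + η) - (1 + η)) *
            (rhoDiag z ^ (-η)) ^ (front n).card := by
          rw [← Real.rpow_natCast, ← Real.rpow_mul hr.le, ← Real.rpow_add hr, card_front]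
          congr 1
          linear_combination hηs
        rw [ENNReal.ofReal_rpow_of_pos hr, this, ENNReal.ofReal_mul (by positivity)]
        ring
    _ ≤ _ := by
        gcongr
        push_cast
        exact le_self_add

end ForelliRudin

theorem rpow_le_two_rpow_abs_mul {x y : ℝ≥0∞} (hx : x ≠ 0) (hx' : x ≠ ∞)
    (hxy : x ≤ 2 * y) (hyx : y ≤ 2 * x) (β : ℝ) : x ^ β ≤ 2 ^ |β| * y ^ β := by
  have hy : y ≠ 0 := fun h => hx (by simpa [h] using hxy)
  have hy' : y ≠ ∞ := ne_top_of_le_ne_top (ENNReal.mul_ne_top (by simp) hx') hyx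
  rcases le_total 0 β with h | h
  · rw [abs_of_nonneg h, ← ENNReal.mul_rpow_of_nonneg _ _ h]
    exact ENNReal.rpow_le_rpow hxy h
  · rw [abs_of_nonpos h]
    have h1 : y ^ (-β) ≤ 2 ^ (-β) * x ^ (-β) := by
      rw [← ENNReal.mul_rpow_of_nonneg _ _ (by linarith)]
      exact ENNReal.rpow_le_rpow hyx (by linarith)
    rw [ENNReal.rpow_neg y, ENNReal.rpow_neg x, ← div_eq_mul_inv] at h1
    have hx2 : x ^ β ≠ 0 := by simp [hx, hx']
    have hx3 : x ^ β ≠ ∞ := by simp [hx, hx']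
    have hy2 : y ^ β ≠ 0 := by simp [hy, hy']
    have hy3 : y ^ β ≠ ∞ := by simp [hy, hy']
    rw [ENNReal.le_div_iff_mul_le (Or.inl hx2) (Or.inl hx3), mul_comm, ← div_eq_mul_inv] at h1
    rwa [ENNReal.div_le_iff hy2 hy3] at h1

/-! ### Growth, embeddings and the geometric condition on μ. -/

section Spaces
variable {n : ℕ} [NeZero n]

/-- `ρ` with values in `[0, ∞]`. -/
noncomputable def weight (z : Cn n) : ℝ≥0∞ := ENNReal.ofReal (rhoDiag z)

theorem measurable_weight' : Measurable (weight : Cn n → ℝ≥0∞) := measurable_weight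

theorem weight_ne_zero {z : Cn n} (hz : z ∈ tube n) : weight z ≠ 0 := by
  simpa [weight] using rhoDiag_pos hz

theorem weight_ne_top (z : Cn n) : weight z ≠ ∞ := ENNReal.ofReal_ne_top

theorem weight_rpow {z : Cn n} (hz : z ∈ tube n) (α : ℝ) :
    ENNReal.ofReal (rhoDiag z ^ α) = weight z ^ α :=
  (ENNReal.ofReal_rpow_of_pos (rhoDiag_pos hz)).symm

theorem weight_rpow_add {z : Cn n} (hz : z ∈ tube n) (α β : ℝ) :
    weight z ^ (α + β) = weight z ^ α * weight z ^ β :=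
  ENNReal.rpow_add _ _ (weight_ne_zero hz) (weight_ne_top z)

theorem weight_le_of_mem_disc {a w : Cn n} (ha : a ∈ tube n) (hw : w ∈ disc a) :
    weight w ≤ 2 * weight a := by
  rw [weight, weight, ← ENNReal.ofReal_ofNat 2, ← ENNReal.ofReal_mul zero_le_two]
  exact ENNReal.ofReal_le_ofReal (rhoDiag_le_of_mem_disc ha hw)

theorem le_weight_of_mem_disc {a w : Cn n} (ha : a ∈ tube n) (hw : w ∈ disc a) :
    weight a ≤ 2 * weight w := by
  rw [weight, weight, ← ENNReal.ofReal_ofNat 2, ← ENNReal.ofReal_mul zero_le_two]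
  exact ENNReal.ofReal_le_ofReal (le_rhoDiag_of_mem_disc ha hw)

theorem enorm_rho_ne_zero {z w : Cn n} (hz : z ∈ tube n) (hw : w ∈ tube n) :
    ‖rho z w‖ₑ ≠ 0 := by
  rw [enorm_ne_zero]
  exact norm_pos_iff.1 (norm_rho_pos hz hw)

theorem enorm_rho_comm (z w : Cn n) : ‖rho z w‖ₑ = ‖rho w z‖ₑ := by
  rw [← ofReal_norm, norm_rho_comm, ofReal_norm]

theorem aemeasurable_enorm {f : Cn n → ℂ} (hf : DifferentiableOn ℂ f (tube n))
    (μ : Measure (Cn n)) : AEMeasurable (fun z => ‖f z‖ₑ) (μ.restrict (tube n)) :=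
  (hf.continuousOn.aemeasurable measurableSet_tube).enorm

theorem aemeasurable_enorm_rpow_mul_weight {f : Cn n → ℂ} (hf : DifferentiableOn ℂ f (tube n))
    (p α : ℝ) (μ : Measure (Cn n)) :
    AEMeasurable (fun z => ‖f z‖ₑ ^ p * weight z ^ α) (μ.restrict (tube n)) :=
  ((aemeasurable_enorm hf μ).pow_const p).mul (measurable_weight'.pow_const α).aemeasurable

theorem measurable_indicator_enorm_rpow_mul_weight {f : Cn n → ℂ}
    (hf : DifferentiableOn ℂ f (tube n)) (p α : ℝ) :
    Measurable ((tube n).indicator fun z => ‖f z‖ₑ ^ p * weight z ^ α) := by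
  have h : ContinuousOn (fun z => ‖f z‖ₑ ^ p) (tube n) :=
    (ENNReal.continuous_rpow_const (y := p)).comp_continuousOn hf.continuousOn.enorm
  have h2 := (measurable_indicator_of_continuousOn measurableSet_tube h).mul
    (measurable_weight'.pow_const α)
  have e : (tube n).indicator (fun z => ‖f z‖ₑ ^ p * weight z ^ α) =
      (tube n).indicator (fun z => ‖f z‖ₑ ^ p) * fun z => weight z ^ α :=
    funext fun z => Set.indicator_mul_left (tube n) (fun z => ‖f z‖ₑ ^ p) fun z => weight z ^ α
  rw [e]
  exact h2

theorem weightedNorm_rpow {p : ℝ} (hp : 0 < p) (α : ℝ) (g : Cn n → ℝ≥0∞) :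
    weightedNorm p α g ^ p = ∫⁻ z in tube n, g z ^ p * weight z ^ α := by
  rw [weightedNorm, ← ENNReal.rpow_mul, one_div_mul_cancel hp.ne', ENNReal.rpow_one]
  exact setLIntegral_congr_fun measurableSet_tube fun z hz => by rw [weight_rpow hz]

theorem bergmanNorm_rpow {p : ℝ} (hp : 0 < p) (α : ℝ) (f : Cn n → ℂ) :
    bergmanNorm p α f ^ p = ∫⁻ z in tube n, ‖f z‖ₑ ^ p * weight z ^ α :=
  weightedNorm_rpow hp α _

/-- The sub-mean value property with weights. -/
theorem exists_enorm_rpow_mul_weight_le (n : ℕ) [NeZero n] (β : ℝ) : ∃ K : ℝ≥0, 0 < K ∧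
    ∀ f : Cn n → ℂ, DifferentiableOn ℂ f (tube n) → ∀ p : ℝ, 0 < p → ∀ a ∈ tube n,
      ‖f a‖ₑ ^ p * weight a ^ ((n : ℝ) + 1 + β) ≤
        K * ∫⁻ w in disc a, ‖f w‖ₑ ^ p * weight w ^ β := by
  have hε := discRadius_pos n
  set c : ℝ := (discRadius n ^ 2 * Real.pi) ^ n with hc
  have hcpos : 0 < c := by positivity
  set K : ℝ≥0∞ := (ENNReal.ofReal c)⁻¹ * 2 ^ |β| with hK
  have hc0 : ENNReal.ofReal c ≠ 0 := by simpa using hcpos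
  have hKtop : K ≠ ∞ := ENNReal.mul_ne_top (by simpa using hcpos)
    (ENNReal.rpow_ne_top_of_nonneg (abs_nonneg _) (by simp))
  have hK0 : K ≠ 0 := by
    refine mul_ne_zero (by simp) ?_
    simp
  refine ⟨K.toNNReal, ENNReal.toNNReal_pos hK0 hKtop, fun f hf p hp a ha => ?_⟩
  rw [ENNReal.coe_toNNReal hKtop]
  have hmean := enorm_rpow_mul_volume_disc_le hf ha hp
  rw [volume_disc ha, ← hc] at hmean
  calc ‖f a‖ₑ ^ p * weight a ^ ((n : ℝ) + 1 + β)
      = (ENNReal.ofReal c)⁻¹ *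
        (‖f a‖ₑ ^ p * (ENNReal.ofReal c * weight a ^ ((n : ℝ) + 1))) * weight a ^ β := by
        rw [weight_rpow_add ha, mul_left_comm (‖f a‖ₑ ^ p) (ENNReal.ofReal c),
          ← mul_assoc (ENNReal.ofReal c)⁻¹, ENNReal.inv_mul_cancel hc0 ENNReal.ofReal_ne_top,
          one_mul, mul_assoc]
    _ ≤ (ENNReal.ofReal c)⁻¹ * (∫⁻ w in disc a, ‖f w‖ₑ ^ p) * weight a ^ β := by
        gcongr
        exact hmean
    _ = (ENNReal.ofReal c)⁻¹ * ∫⁻ w in disc a, ‖f w‖ₑ ^ p * weight a ^ β := by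
        rw [lintegral_mul_const' _ _ (by simp [weight_ne_zero ha, weight_ne_top a]), mul_assoc]
    _ ≤ (ENNReal.ofReal c)⁻¹ * ∫⁻ w in disc a, 2 ^ |β| * (‖f w‖ₑ ^ p * weight w ^ β) := by
        refine mul_le_mul_right (setLIntegral_mono' (isOpen_disc a).measurableSet fun w hw => ?_) _
        rw [mul_left_comm]
        gcongr
        exact rpow_le_two_rpow_abs_mul (weight_ne_zero ha) (weight_ne_top a)
          (le_weight_of_mem_disc ha hw) (weight_le_of_mem_disc ha hw) β
    _ = _ := by
        rw [lintegral_const_mul' _ _ (ENNReal.rpow_ne_top_of_nonneg (abs_nonneg _) (by simp)),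
          mul_assoc]

/-- The pointwise growth estimate in weighted Bergman spaces. -/
theorem exists_enorm_rpow_mul_weight_le_lintegral_tube (n : ℕ) [NeZero n] (α : ℝ) :
    ∃ K : ℝ≥0, 0 < K ∧
    ∀ f : Cn n → ℂ, DifferentiableOn ℂ f (tube n) → ∀ p : ℝ, 0 < p → ∀ a ∈ tube n,
      ‖f a‖ₑ ^ p * weight a ^ ((n : ℝ) + 1 + α) ≤
        K * ∫⁻ w in tube n, ‖f w‖ₑ ^ p * weight w ^ α := by
  obtain ⟨K, hK, h⟩ := exists_enorm_rpow_mul_weight_le n α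
  refine ⟨K, hK, fun f hf p hp a ha => (h f hf p hp a ha).trans ?_⟩
  gcongr
  exact disc_subset_tube ha

/-- The embedding of weighted Bergman spaces with `(n + 1 + α) / p = (n + 1 + β) / q`, `p ≤ q`. -/
theorem exists_lintegral_le_rpow (n : ℕ) [NeZero n] (α : ℝ) : ∃ K : ℝ≥0, 0 < K ∧
    ∀ f : Cn n → ℂ, DifferentiableOn ℂ f (tube n) → ∀ p q β : ℝ, 0 < p → p ≤ q →
      (n : ℝ) + 1 + β = q / p * (n + 1 + α) →
      ∫⁻ w in tube n, ‖f w‖ₑ ^ q * weight w ^ β ≤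
        (K : ℝ≥0∞) ^ (q / p - 1) * (∫⁻ w in tube n, ‖f w‖ₑ ^ p * weight w ^ α) ^ (q / p) := by
  obtain ⟨K, hK, h⟩ := exists_enorm_rpow_mul_weight_le_lintegral_tube n α
  refine ⟨K, hK, fun f hf p q β hp hpq hβ => ?_⟩
  have hθ : 0 ≤ q / p - 1 := by
    rw [sub_nonneg, one_le_div hp]
    exact hpq
  set I := ∫⁻ w in tube n, ‖f w‖ₑ ^ p * weight w ^ α with hI
  calc ∫⁻ w in tube n, ‖f w‖ₑ ^ q * weight w ^ β
      ≤ ∫⁻ w in tube n, (K * I) ^ (q / p - 1) * (‖f w‖ₑ ^ p * weight w ^ α) := by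
        refine setLIntegral_mono' measurableSet_tube fun w hw => ?_
        -- Write |f|^q = |f|^(q-p)·|f|^p and apply the growth estimate to the first factor; the
        -- relation between α and β makes the weights match.
        calc ‖f w‖ₑ ^ q * weight w ^ β
            = (‖f w‖ₑ ^ p * weight w ^ ((n : ℝ) + 1 + α)) ^ (q / p - 1) *
              (‖f w‖ₑ ^ p * weight w ^ α) := by
              rw [ENNReal.mul_rpow_of_nonneg _ _ hθ, mul_mul_mul_comm, ← ENNReal.rpow_mul,
                ← ENNReal.rpow_mul, ← weight_rpow_add hw,
                ← ENNReal.rpow_add_of_nonneg _ _ (mul_nonneg hp.le hθ) hp.le]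
              congr 2
              · field_simp; ring
              · linear_combination hβ
          _ ≤ _ := by
              refine mul_le_mul_left (ENNReal.rpow_le_rpow ?_ hθ) _
              exact h f hf p hp w hw
    _ = (K * I) ^ (q / p - 1) * I := by
        rw [lintegral_const_mul'' _ (aemeasurable_enorm_rpow_mul_weight hf p α volume)]
    _ = _ := by
        rw [ENNReal.mul_rpow_of_nonneg _ _ hθ, mul_assoc]
        congr 1
        nth_rewrite 2 [← ENNReal.rpow_one I]
        rw [← ENNReal.rpow_add_of_nonneg _ _ hθ zero_le_one, sub_add_cancel]

/-- The points whose polydisc contains `u`. -/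
def dualDisc (u : Cn n) : Set (Cn n) := tube n ∩ {w | u ∈ disc w}

/-- The best constant in the estimate `μ(dualDisc u) ≤ C ρ(u)^κ`. -/
noncomputable def geometricNorm (κ : ℝ) (μ : Measure (Cn n)) : ℝ≥0∞ :=
  ⨆ u ∈ tube n, μ (dualDisc u) / weight u ^ κ

theorem measure_dualDisc_le (κ : ℝ) (μ : Measure (Cn n)) {u : Cn n} (hu : u ∈ tube n) :
    μ (dualDisc u) ≤ geometricNorm κ μ * weight u ^ κ := by
  have h0 := weight_ne_zero hu
  have ht := weight_ne_top u
  rw [← ENNReal.div_le_iff (by simp [h0, ht]) (by simp [h0, ht])]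
  exact le_iSup₂ (f := fun u (_ : u ∈ tube n) => μ (dualDisc u) / weight u ^ κ) u hu

theorem geometricNorm_le {κ : ℝ} {μ : Measure (Cn n)} {C : ℝ≥0∞}
    (h : ∀ u ∈ tube n, μ (dualDisc u) ≤ C * weight u ^ κ) : geometricNorm κ μ ≤ C := by
  refine iSup₂_le fun u hu => ?_
  have h0 := weight_ne_zero hu
  have ht := weight_ne_top u
  rw [ENNReal.div_le_iff (by simp [h0, ht]) (by simp [h0, ht])]
  exact h u hu

/-- Integrals with respect to `μ` are dominated by integrals with respect to a weight. -/
theorem exists_lintegral_le_geometricNorm (n : ℕ) [NeZero n] : ∃ K : ℝ≥0, 0 < K ∧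
    ∀ (μ : Measure (Cn n)) [SFinite (μ.restrict (tube n))] (f : Cn n → ℂ),
      DifferentiableOn ℂ f (tube n) → ∀ q κ : ℝ, 0 < q →
      ∫⁻ w in tube n, ‖f w‖ₑ ^ q ∂μ ≤ K * geometricNorm κ μ *
        ∫⁻ u in tube n, ‖f u‖ₑ ^ q * weight u ^ (κ - (n + 1)) := by
  -- The weight exponent -(n+1) removes the power of ρ at the centre, leaving |f|^q alone.
  obtain ⟨K, hK, h⟩ := exists_enorm_rpow_mul_weight_le n (-(n + 1))
  refine ⟨K, hK, fun μ _ f hf q κ hq => ?_⟩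
  set g : Cn n → ℝ≥0∞ := (tube n).indicator fun u => ‖f u‖ₑ ^ q * weight u ^ (-((n : ℝ) + 1))
    with hg
  have hgm : Measurable g := by
    exact measurable_indicator_enorm_rpow_mul_weight hf q _
  have hS : MeasurableSet {x : Cn n × Cn n | x.2 ∈ disc x.1} := isOpen_setOf_mem_disc.measurableSet
  calc ∫⁻ w in tube n, ‖f w‖ₑ ^ q ∂μ
      ≤ ∫⁻ w in tube n, K * (∫⁻ u, {x : Cn n × Cn n | x.2 ∈ disc x.1}.indicator
          (fun x => g x.2) (w, u)) ∂μ := by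
        refine setLIntegral_mono' measurableSet_tube fun w hw => ?_
        have h1 := h f hf q hq w hw
        rw [add_neg_cancel, ENNReal.rpow_zero, mul_one] at h1
        refine h1.trans_eq ?_
        rw [← lintegral_indicator (isOpen_disc w).measurableSet]
        congr 1
        refine lintegral_congr fun u => ?_
        by_cases hu : u ∈ disc w
        · rw [Set.indicator_of_mem hu, Set.indicator_of_mem (show (w, u) ∈ _ from hu), hg,
            Set.indicator_of_mem (disc_subset_tube hw hu)]
        · rw [Set.indicator_of_notMem hu, Set.indicator_of_notMem (show (w, u) ∉ _ from hu)]
    -- By Tonelli, for fixed u the points w with u in `disc w` form `dualDisc u`, so its μ-measure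
    -- appears without any covering argument.
    _ = K * ∫⁻ u, (∫⁻ w in tube n, {x : Cn n × Cn n | x.2 ∈ disc x.1}.indicator
          (fun x => g x.2) (w, u) ∂μ) := by
        have hm : Measurable ({x : Cn n × Cn n | x.2 ∈ disc x.1}.indicator fun x => g x.2) :=
          (hgm.comp measurable_snd).indicator hS
        rw [lintegral_const_mul _ hm.lintegral_prod_right']
        congr 1
        exact lintegral_lintegral_swap hm.aemeasurable
    _ = K * ∫⁻ u, g u * μ (dualDisc u) := by
        congr 1
        refine lintegral_congr fun u => ?_
        have hSu : MeasurableSet {w : Cn n | u ∈ disc w} := hS.preimage measurable_prodMk_right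
        have : ∀ w, {x : Cn n × Cn n | x.2 ∈ disc x.1}.indicator (fun x => g x.2) (w, u)
            = {w : Cn n | u ∈ disc w}.indicator (fun _ => g u) w := fun w => rfl
        simp only [this]
        rw [lintegral_indicator hSu, setLIntegral_const, Measure.restrict_apply hSu, dualDisc,
          Set.inter_comm]
    _ ≤ K * ∫⁻ u, geometricNorm κ μ *
          (tube n).indicator (fun u => ‖f u‖ₑ ^ q * weight u ^ (κ - (n + 1))) u := by
        refine mul_le_mul_right (lintegral_mono fun u => ?_) _
        by_cases hu : u ∈ tube n
        · have h1 := measure_dualDisc_le κ μ hu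
          rw [hg, Set.indicator_of_mem hu, Set.indicator_of_mem hu, sub_eq_neg_add,
            weight_rpow_add hu]
          refine (mul_le_mul_right h1 _).trans_eq ?_
          ring
        · rw [hg, Set.indicator_of_notMem hu, zero_mul]
          exact zero_le
    _ = _ := by
        rw [lintegral_const_mul _ (measurable_indicator_enorm_rpow_mul_weight hf q _),
          lintegral_indicator measurableSet_tube, mul_assoc]

end Spaces
-- Powers of ρ(·, a) as test functions, and Carleson measures.
section TestFunctions
variable {n : ℕ} [NeZero n]

theorem differentiableOn_rho_cpow {a : Cn n} (ha : a ∈ tube n) (c : ℂ) :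
    DifferentiableOn ℂ (fun w => rho w a ^ c) (tube n) := by
  have h : Differentiable ℂ fun w : Cn n => rho w a := by
    unfold rho; fun_prop
  exact h.differentiableOn.cpow_const fun w hw => rho_mem_slitPlane hw ha

theorem enorm_cpow_real (x : ℂ) {s : ℝ} (hx : x ≠ 0) : ‖x ^ (s : ℂ)‖ₑ = ‖x‖ₑ ^ s := by
  rw [← ofReal_norm, Complex.norm_cpow_real, ← ofReal_norm,
    ENNReal.ofReal_rpow_of_pos (norm_pos_iff.2 hx)]

theorem rho_ne_zero {z w : Cn n} (hz : z ∈ tube n) (hw : w ∈ tube n) : rho z w ≠ 0 :=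
  norm_pos_iff.1 (norm_rho_pos hz hw)

/-- The test functions `ρ(·, a)^{-s}`. -/
noncomputable def testFun (a : Cn n) (s : ℝ) (w : Cn n) : ℂ := rho w a ^ ((-s : ℝ) : ℂ)

theorem differentiableOn_testFun {a : Cn n} (ha : a ∈ tube n) (s : ℝ) :
    DifferentiableOn ℂ (testFun a s) (tube n) := differentiableOn_rho_cpow ha _

theorem enorm_testFun {a w : Cn n} (ha : a ∈ tube n) (hw : w ∈ tube n) (s : ℝ) :
    ‖testFun a s w‖ₑ = ‖rho a w‖ₑ ^ (-s) := by
  rw [testFun, enorm_cpow_real _ (rho_ne_zero hw ha), enorm_rho_comm]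

theorem lintegral_testFun {a : Cn n} (ha : a ∈ tube n) (s p α : ℝ) :
    ∫⁻ w in tube n, ‖testFun a s w‖ₑ ^ p * weight w ^ α =
      ∫⁻ w in tube n, weight w ^ α * ‖rho a w‖ₑ ^ (-(s * p)) :=
  setLIntegral_congr_fun measurableSet_tube fun w hw => by
    rw [enorm_testFun ha hw, ← ENNReal.rpow_mul, neg_mul, mul_comm]

/-- The Forelli–Rudin estimate for the function `weight`. -/
theorem exists_lintegral_weight_le (n : ℕ) [NeZero n] {α s : ℝ} (hα : -1 < α) (hs : n + 1 + α < s) :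
    ∃ C : ℝ≥0, 0 < C ∧ ∀ z ∈ tube n,
      ∫⁻ w in tube n, weight w ^ α * ‖rho z w‖ₑ ^ (-s) ≤ C * weight z ^ (n + 1 + α - s) :=
  exists_lintegral_rho_le hα hs

theorem measurableSet_dualDisc (u : Cn n) : MeasurableSet (dualDisc u) :=
  measurableSet_tube.inter (isOpen_setOf_mem_disc.measurableSet.preimage measurable_prodMk_right)

theorem enorm_rho_le_of_mem_dualDisc {a w : Cn n} (hw : w ∈ dualDisc a) :
    ‖rho a w‖ₑ ≤ 2 * weight a := by
  rw [weight, ← ENNReal.ofReal_ofNat 2, ← ENNReal.ofReal_mul zero_le_two, ← ofReal_norm]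
  exact ENNReal.ofReal_le_ofReal (norm_rho_le_mul_rhoDiag hw.1 hw.2)

/-- Integrals of the kernel control the measure of the dual polydiscs. -/
theorem measure_dualDisc_le_lintegral (μ : Measure (Cn n)) {a : Cn n} (ha : a ∈ tube n) {t : ℝ}
    (ht : 0 ≤ t) :
    μ (dualDisc a) ≤ 2 ^ t * weight a ^ t * ∫⁻ w in tube n, ‖rho a w‖ₑ ^ (-t) ∂μ := by
  have h0 : (2 * weight a) ^ t ≠ 0 := by
    have := weight_ne_zero ha
    have := weight_ne_top a
    simp [*, ENNReal.mul_eq_top]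
  have h1 : (2 * weight a) ^ t ≠ ∞ :=
    ENNReal.rpow_ne_top_of_nonneg ht (ENNReal.mul_ne_top (by simp) (weight_ne_top a))
  have h : (2 * weight a) ^ (-t) * μ (dualDisc a) ≤ ∫⁻ w in tube n, ‖rho a w‖ₑ ^ (-t) ∂μ := by
    rw [← setLIntegral_const]
    refine (setLIntegral_mono' (measurableSet_dualDisc a) fun w hw => ?_).trans
      (lintegral_mono_set Set.inter_subset_left)
    rw [ENNReal.rpow_neg, ENNReal.rpow_neg, ENNReal.inv_le_inv]
    exact ENNReal.rpow_le_rpow (enorm_rho_le_of_mem_dualDisc hw) ht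
  rw [← ENNReal.mul_rpow_of_nonneg _ _ ht]
  calc μ (dualDisc a) = (2 * weight a) ^ t * ((2 * weight a) ^ (-t) * μ (dualDisc a)) := by
        rw [ENNReal.rpow_neg, ← mul_assoc, ENNReal.mul_inv_cancel h0 h1, one_mul]
    _ ≤ _ := mul_le_mul_right h _

theorem bergmanNorm_const_mul {p : ℝ} (hp : 0 < p) (α : ℝ) (c : ℂ) (f : Cn n → ℂ) :
    bergmanNorm p α (fun z => c * f z) = ‖c‖ₑ * bergmanNorm p α f := by
  have h : ∀ z, ‖c * f z‖ₑ ^ p * ENNReal.ofReal (rhoDiag z ^ α) =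
      ‖c‖ₑ ^ p * (‖f z‖ₑ ^ p * ENNReal.ofReal (rhoDiag z ^ α)) := fun z => by
    rw [enorm_mul, ENNReal.mul_rpow_of_nonneg _ _ hp.le, mul_assoc]
  simp only [bergmanNorm, weightedNorm, h]
  rw [lintegral_const_mul' _ _ (ENNReal.rpow_ne_top_of_nonneg hp.le enorm_ne_top),
    ENNReal.mul_rpow_of_nonneg _ _ (by positivity), ← ENNReal.rpow_mul, mul_one_div_cancel hp.ne',
    ENNReal.rpow_one]

/-- Homogeneity. Dividing by an upper bound `A`, nonzero and finite, rather than by the norm itself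
avoids treating norm 0 separately. -/
theorem lintegral_le_rpow_mul_carlesonNorm {p q α : ℝ} (hp : 0 < p) (hq : 0 < q)
    (μ : Measure (Cn n)) {f : Cn n → ℂ} (hf : DifferentiableOn ℂ f (tube n)) {A : ℝ≥0∞}
    (hA : A ≠ 0) (hA' : A ≠ ∞) (hfA : bergmanNorm p α f ≤ A) :
    ∫⁻ z in tube n, ‖f z‖ₑ ^ q ∂μ ≤ A ^ q * carlesonNorm p q α μ := by
  set c : ℂ := ((A.toReal⁻¹ : ℝ) : ℂ) with hc
  have hAr : 0 < A.toReal := ENNReal.toReal_pos hA hA'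
  have hcn : ‖c‖ₑ = A⁻¹ := by
    rw [hc, ← ofReal_norm, Complex.norm_real, Real.norm_of_nonneg (by positivity),
      ENNReal.ofReal_inv_of_pos hAr, ENNReal.ofReal_toReal hA']
  have hnorm : bergmanNorm p α (fun z => c * f z) ≤ 1 := by
    rw [bergmanNorm_const_mul hp, hcn]
    calc A⁻¹ * bergmanNorm p α f ≤ A⁻¹ * A := by gcongr
      _ = 1 := ENNReal.inv_mul_cancel hA hA'
  have hmem : (fun z => c * f z) ∈ BergmanSpace n p α :=
    ⟨(differentiableOn_const c).mul hf, hnorm.trans_lt ENNReal.one_lt_top⟩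
  have h := le_iSup₂_of_le (f := fun (f : Cn n → ℂ) (_ : f ∈ BergmanSpace n p α) =>
    ⨆ (_ : bergmanNorm p α f ≤ 1), ∫⁻ z in tube n, ‖f z‖ₑ ^ q ∂μ) _ hmem
    (le_iSup_of_le hnorm le_rfl)
  change _ ≤ carlesonNorm p q α μ at h
  have hAq : A ^ q ≠ ∞ := ENNReal.rpow_ne_top_of_nonneg hq.le hA'
  calc ∫⁻ z in tube n, ‖f z‖ₑ ^ q ∂μ = A ^ q * ∫⁻ z in tube n, ‖c * f z‖ₑ ^ q ∂μ := by
        rw [← lintegral_const_mul' _ _ hAq]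
        refine lintegral_congr fun z => ?_
        rw [enorm_mul, hcn, ← ENNReal.mul_rpow_of_nonneg _ _ hq.le, ← mul_assoc,
          ENNReal.mul_inv_cancel hA hA', one_mul]
    _ ≤ _ := mul_le_mul_right h _

/-- Carleson measures satisfy the geometric condition, with a constant independent of the pair of
exponents. -/
theorem exists_geometricNorm_le_carlesonNorm (n : ℕ) [NeZero n] {lam γ : ℝ} (hlam : 0 < lam)
    (hγ : -1 < γ) : ∃ K : ℝ≥0, 0 < K ∧ ∀ (μ : Measure (Cn n)) (p q : ℝ), 0 < p → 0 < q →
      q / p = lam → geometricNorm (lam * (n + 1 + γ)) μ ≤ K * carlesonNorm p q γ μ := by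
  -- Any N > n+1+γ would do. For the test function with exponent N/p, the p-th power of the modulus
  -- has kernel exponent N and the q-th power Nλ; so the constants depend on λ but not on p and q.
  set N : ℝ := n + 1 + γ + 1 with hN
  have hNpos : 0 < N := by linarith [n.cast_nonneg (α := ℝ)]
  obtain ⟨C, hC, hFR⟩ := exists_lintegral_weight_le n hγ (s := N) (by linarith)
  refine ⟨2 ^ (N * lam) * C ^ lam, by positivity, fun μ p q hp hq hpq => ?_⟩
  refine geometricNorm_le fun a ha => ?_
  have hw0 := weight_ne_zero ha
  have hwt := weight_ne_top a
  set A : ℝ≥0∞ := (C * weight a ^ (n + 1 + γ - N)) ^ (1 / p) with hA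
  have hbase0 : (C : ℝ≥0∞) * weight a ^ (n + 1 + γ - N) ≠ 0 :=
    mul_ne_zero (by simpa using hC.ne') (by simp [hw0, hwt])
  have hbaset : (C : ℝ≥0∞) * weight a ^ (n + 1 + γ - N) ≠ ∞ :=
    ENNReal.mul_ne_top (by simp) (by simp [hw0, hwt])
  have hA0 : A ≠ 0 := by simp [hA, hbase0, hbaset]
  have hAt : A ≠ ∞ := ENNReal.rpow_ne_top_of_nonneg (by positivity) hbaset
  have hnorm : bergmanNorm p γ (testFun a (N / p)) ≤ A := by
    rw [hA, one_div, ENNReal.le_rpow_inv_iff hp, bergmanNorm_rpow hp, lintegral_testFun ha,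
      div_mul_cancel₀ _ hp.ne']
    exact hFR a ha
  have h1 := lintegral_le_rpow_mul_carlesonNorm hp hq μ (differentiableOn_testFun ha (N / p))
    hA0 hAt hnorm
  have h2 : ∫⁻ w in tube n, ‖testFun a (N / p) w‖ₑ ^ q ∂μ =
      ∫⁻ w in tube n, ‖rho a w‖ₑ ^ (-(N * lam)) ∂μ :=
    setLIntegral_congr_fun measurableSet_tube fun w hw => by
      rw [enorm_testFun ha hw, ← ENNReal.rpow_mul, ← hpq]
      congr 1
      ring
  rw [h2] at h1
  refine (measure_dualDisc_le_lintegral μ ha (t := N * lam) (by positivity)).trans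
    ((mul_le_mul_right h1 _).trans_eq ?_)
  rw [hA, ← ENNReal.rpow_mul, one_div_mul_eq_div, hpq, ENNReal.mul_rpow_of_nonneg _ _ hlam.le,
    ← ENNReal.rpow_mul, show lam * ((n : ℝ) + 1 + γ) = N * lam + (n + 1 + γ - N) * lam by ring,
    weight_rpow_add ha, ENNReal.coe_mul, ENNReal.coe_rpow_of_nonneg _ hlam.le,
    ENNReal.coe_rpow_of_nonneg _ (by positivity), ENNReal.coe_ofNat]
  ring

/-- The geometric condition implies the Carleson embedding, with a constant independent of the pair
of exponents. -/
theorem exists_lintegral_le_geometricNorm_mul_bergmanNorm (n : ℕ) [NeZero n] {lam : ℝ}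
    (hlam : 1 ≤ lam) (γ : ℝ) : ∃ K : ℝ≥0, 0 < K ∧
    ∀ (μ : Measure (Cn n)) [SFinite (μ.restrict (tube n))] (p q : ℝ), 0 < p → 0 < q →
      q / p = lam → ∀ f : Cn n → ℂ, DifferentiableOn ℂ f (tube n) →
      ∫⁻ w in tube n, ‖f w‖ₑ ^ q ∂μ ≤
        K * geometricNorm (lam * (n + 1 + γ)) μ * bergmanNorm p γ f ^ q := by
  obtain ⟨K₁, hK₁, h₁⟩ := exists_lintegral_le_geometricNorm n
  obtain ⟨K₂, hK₂, h₂⟩ := exists_lintegral_le_rpow n γ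
  refine ⟨K₁ * K₂ ^ (lam - 1), by positivity, fun μ _ p q hp hq hpq f hf => ?_⟩
  have hpq' : p ≤ q := by rw [← hpq, one_le_div hp] at hlam; exact hlam
  have h3 := h₂ f hf p q (lam * (n + 1 + γ) - (n + 1)) hp hpq' (by rw [hpq]; ring)
  refine (h₁ μ f hf q (lam * (n + 1 + γ)) hq).trans ((mul_le_mul_right h3 _).trans_eq ?_)
  have h4 : bergmanNorm p γ f ^ q = (∫⁻ w in tube n, ‖f w‖ₑ ^ p * weight w ^ γ) ^ (q / p) := by
    rw [← bergmanNorm_rpow hp, ← ENNReal.rpow_mul, mul_div_cancel₀ _ hp.ne']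
  rw [h4, hpq, ENNReal.coe_mul, ENNReal.coe_rpow_of_nonneg _ (by linarith)]
  ring

end TestFunctions
-- The Toeplitz operator: domination by the Berezin operator, and necessity.
section Toeplitz
variable {n : ℕ} [NeZero n]

theorem basePt_mem_tube (n : ℕ) [NeZero n] : basePt n ∈ tube n := by
  rw [mem_tube_iff, rhoDiag, basePt, Finset.sum_eq_zero fun i hi => by
    rw [Pi.single_eq_of_ne (Finset.ne_of_mem_erase hi)]; simp]
  simp

/-- Weighting μ by |ρ(·,𝐢)|^(-t) gives a finite measure, and that density is positive and finite on
the tube, so it can be inverted. S-finiteness, needed for Tonelli, is all that is used of 𝓜₊. -/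
theorem sFinite_restrict_of_mem_MPlus {μ : Measure (Cn n)} (hμ : μ ∈ MPlus n) :
    SFinite (μ.restrict (tube n)) := by
  obtain ⟨t, ht, hfin⟩ := hμ
  set g : Cn n → ℝ≥0∞ := fun z => (‖rho z (basePt n)‖ₑ ^ t)⁻¹ with hg
  have hgm : Measurable g := by
    have h := (measurable_enorm_rho (n := n)).comp (measurable_prodMk_right (y := basePt n))
    exact (h.pow_const t).inv
  have : IsFiniteMeasure ((μ.restrict (tube n)).withDensity g) :=
    isFiniteMeasure_withDensity hfin.ne
  rw [← withDensity_inv_same (μ := μ.restrict (tube n)) hgm]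
  · infer_instance
  · exact .of_forall fun z => ENNReal.inv_ne_zero.2 (ENNReal.rpow_ne_top_of_nonneg ht.le enorm_ne_top)
  · refine (ae_restrict_mem measurableSet_tube).mono fun z hz => ?_
    have := enorm_rho_ne_zero hz (basePt_mem_tube n)
    simp [hg, this]

theorem enorm_toeplitzIntegrand {ξ : ℝ} (f : Cn n → ℂ) {z w : Cn n}
    (hz : z ∈ tube n) (hw : w ∈ tube n) :
    ‖toeplitzIntegrand ξ f z w‖ₑ = ‖f w‖ₑ / ‖rho z w‖ₑ ^ ((n : ℝ) + 1 + ξ) := by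
  have h := rho_ne_zero hz hw
  have h2 : rho z w ^ (((n : ℝ) + 1 + ξ : ℝ) : ℂ) ≠ 0 := by
    rw [Ne, Complex.cpow_eq_zero_iff]
    exact fun hc => h hc.1
  rw [toeplitzIntegrand, div_eq_mul_inv, enorm_mul, enorm_inv h2, enorm_cpow_real _ h,
    ← div_eq_mul_inv]

theorem lintegral_enorm_toeplitzIntegrand (μ : Measure (Cn n)) (ξ : ℝ) (f : Cn n → ℂ) {z : Cn n}
    (hz : z ∈ tube n) :
    ∫⁻ w in tube n, ‖toeplitzIntegrand ξ f z w‖ₑ ∂μ = berezin μ ξ f z :=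
  setLIntegral_congr_fun measurableSet_tube fun _ hw => enorm_toeplitzIntegrand f hz hw

theorem continuousOn_toeplitzIntegrand (ξ : ℝ) {f : Cn n → ℂ} (hf : ContinuousOn f (tube n))
    {z : Cn n} (hz : z ∈ tube n) : ContinuousOn (toeplitzIntegrand ξ f z) (tube n) := by
  have h : Continuous fun w : Cn n => rho z w := by
    unfold rho; fun_prop
  refine hf.div (h.continuousOn.cpow_const fun w hw => rho_mem_slitPlane hz hw) fun w hw => ?_
  rw [Ne, Complex.cpow_eq_zero_iff]
  exact fun hc => rho_ne_zero hz hw hc.1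

theorem aestronglyMeasurable_toeplitzIntegrand (μ : Measure (Cn n)) (ξ : ℝ) {f : Cn n → ℂ}
    (hf : ContinuousOn f (tube n)) {z : Cn n} (hz : z ∈ tube n) :
    AEStronglyMeasurable (toeplitzIntegrand ξ f z) (μ.restrict (tube n)) :=
  (continuousOn_toeplitzIntegrand ξ hf hz).aestronglyMeasurable measurableSet_tube

theorem differentiableOn_toeplitzIntegrand (ξ : ℝ) (f : Cn n → ℂ) {w : Cn n} (hw : w ∈ tube n) :
    DifferentiableOn ℂ (fun z => toeplitzIntegrand ξ f z w) (tube n) := by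
  simp only [toeplitzIntegrand, div_eq_mul_inv, ← Complex.cpow_neg]
  exact (differentiableOn_rho_cpow hw _).const_mul _

/-- The kernel is essentially constant on polydiscs. -/
theorem enorm_toeplitzIntegrand_le {ξ : ℝ} (hξ : 0 ≤ (n : ℝ) + 1 + ξ) (f : Cn n → ℂ)
    {z u w : Cn n} (hz : z ∈ tube n) (hw : w ∈ tube n)
    (h₁ : ‖rho w z‖ ≤ 2 * ‖rho w u‖) (hu : u ∈ tube n) :
    ‖toeplitzIntegrand ξ f u w‖ₑ ≤ 2 ^ ((n : ℝ) + 1 + ξ) * ‖toeplitzIntegrand ξ f z w‖ₑ := by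
  rw [enorm_toeplitzIntegrand f hz hw, enorm_toeplitzIntegrand f hu hw]
  have h2 : ‖rho z w‖ₑ ≤ 2 * ‖rho u w‖ₑ := by
    rw [enorm_rho_comm z, enorm_rho_comm u, ← ofReal_norm, ← ofReal_norm, ← ENNReal.ofReal_ofNat 2,
      ← ENNReal.ofReal_mul zero_le_two]
    exact ENNReal.ofReal_le_ofReal h₁
  have h3 := ENNReal.rpow_le_rpow h2 hξ
  rw [ENNReal.mul_rpow_of_nonneg _ _ hξ] at h3
  have hz0 : ‖rho z w‖ₑ ^ ((n : ℝ) + 1 + ξ) ≠ 0 := by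
    simp [enorm_rho_ne_zero hz hw]
  have hu0 : ‖rho u w‖ₑ ^ ((n : ℝ) + 1 + ξ) ≠ 0 := by
    simp [enorm_rho_ne_zero hu hw]
  have hzt : ‖rho z w‖ₑ ^ ((n : ℝ) + 1 + ξ) ≠ ∞ := ENNReal.rpow_ne_top_of_nonneg hξ enorm_ne_top
  have hut : ‖rho u w‖ₑ ^ ((n : ℝ) + 1 + ξ) ≠ ∞ := ENNReal.rpow_ne_top_of_nonneg hξ enorm_ne_top
  rw [ENNReal.div_le_iff hu0 hut]
  calc ‖f w‖ₑ = ‖f w‖ₑ / ‖rho z w‖ₑ ^ ((n : ℝ) + 1 + ξ) * ‖rho z w‖ₑ ^ ((n : ℝ) + 1 + ξ) :=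
        (ENNReal.div_mul_cancel hz0 hzt).symm
    _ ≤ ‖f w‖ₑ / ‖rho z w‖ₑ ^ ((n : ℝ) + 1 + ξ) *
        (2 ^ ((n : ℝ) + 1 + ξ) * ‖rho u w‖ₑ ^ ((n : ℝ) + 1 + ξ)) := mul_le_mul_right h3 _
    _ = _ := by ring

/-- Boundedness of the Berezin operator implies boundedness of the Toeplitz operator. -/
theorem BerezinBoundedBy.toeplitzBoundedBy {p₁ α₁ p₂ α₂ ξ : ℝ} (hp₂ : 0 < p₂)
    (hξ : 0 ≤ (n : ℝ) + 1 + ξ) {μ : Measure (Cn n)} {C : ℝ≥0}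
    (h : BerezinBoundedBy p₁ α₁ p₂ α₂ ξ μ C) : ToeplitzBoundedBy p₁ α₁ p₂ α₂ ξ μ C := by
  intro f hf
  obtain ⟨⟨hmeas, hfin⟩, hle⟩ := h f hf
  have hfc := hf.1.continuousOn
  have hae : ∀ᵐ z ∂(volume.restrict (tube n)), berezin μ ξ f z < ∞ := by
    have h1 : ∫⁻ z in tube n, berezin μ ξ f z ^ p₂ * weight z ^ α₂ ≠ ∞ := by
      rw [← weightedNorm_rpow hp₂]
      exact ENNReal.rpow_ne_top_of_nonneg hp₂.le hfin.ne
    have h2 := ae_lt_top' ((hmeas.pow_const p₂).mul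
      (measurable_weight'.pow_const α₂).aemeasurable) h1
    filter_upwards [h2, ae_restrict_mem measurableSet_tube] with z hz hzt
    by_contra hc
    rw [not_lt, top_le_iff] at hc
    rw [Pi.mul_apply, hc, ENNReal.top_rpow_of_pos hp₂, ENNReal.top_mul] at hz
    · exact hz.ne rfl
    · simp [weight_ne_zero hzt, weight_ne_top z]
  -- Finiteness almost everywhere becomes finiteness everywhere: `disc z` has positive volume, hence
  -- contains a point where the integral is finite, and the kernels at the two points are
  -- comparable.
  have hber : ∀ z ∈ tube n, berezin μ ξ f z < ∞ := by
    intro z hz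
    have hpos : volume.restrict (tube n) (disc z) ≠ 0 := by
      rw [Measure.restrict_eq_self _ (disc_subset_tube hz)]
      exact ((isOpen_disc z).measure_pos _ ⟨z, self_mem_disc hz⟩).ne'
    obtain ⟨u, hu, hufin⟩ : ∃ u ∈ disc z, berezin μ ξ f u < ∞ := by
      by_contra hc
      push Not at hc
      refine hpos (measure_mono_null (fun u hu => ?_) (ae_iff.1 hae))
      exact not_lt.2 (hc u hu)
    have hut := disc_subset_tube hz hu
    rw [← lintegral_enorm_toeplitzIntegrand μ ξ f hz]
    rw [← lintegral_enorm_toeplitzIntegrand μ ξ f hut] at hufin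
    have h2t : (2 : ℝ≥0∞) ^ ((n : ℝ) + 1 + ξ) ≠ ∞ := ENNReal.rpow_ne_top_of_nonneg hξ (by simp)
    refine lt_of_le_of_lt (setLIntegral_mono' measurableSet_tube fun w hw =>
      enorm_toeplitzIntegrand_le hξ f hut hw (norm_rho_le_of_mem_disc hz hu hw) hz) ?_
    rw [lintegral_const_mul' _ _ h2t]
    exact ENNReal.mul_lt_top h2t.lt_top hufin
  have hint : ∀ z ∈ tube n, IntegrableOn (toeplitzIntegrand ξ f z) (tube n) μ := fun z hz =>
    ⟨aestronglyMeasurable_toeplitzIntegrand μ ξ hfc hz, by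
      rw [HasFiniteIntegral, lintegral_enorm_toeplitzIntegrand μ ξ f hz]
      exact hber z hz⟩
  have hnorm : bergmanNorm p₂ α₂ (toeplitz μ ξ f) ≤ weightedNorm p₂ α₂ (berezin μ ξ f) := by
    refine ENNReal.rpow_le_rpow (setLIntegral_mono' measurableSet_tube fun z hz => ?_)
      (by positivity)
    gcongr
    rw [← lintegral_enorm_toeplitzIntegrand μ ξ f hz]
    exact enorm_integral_le_lintegral_enorm _
  refine ⟨hint, ⟨?_, hnorm.trans_lt hfin⟩, hnorm.trans hle⟩
  -- The same comparison provides the local domination: on `disc z` the integrand is at most a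
  -- constant times the modulus of its value at z.
  refine differentiableOn_integral_of_dominated isOpen_tube
    (fun z hz => aestronglyMeasurable_toeplitzIntegrand μ ξ hfc hz)
    ((ae_restrict_mem measurableSet_tube).mono fun w hw => differentiableOn_toeplitzIntegrand ξ f hw)
    fun z hz => ⟨disc z, (isOpen_disc z).mem_nhds (self_mem_disc hz),
      fun w => 2 ^ ((n : ℝ) + 1 + ξ) * ‖toeplitzIntegrand ξ f z w‖, (hint z hz).norm.const_mul _,
      (ae_restrict_mem measurableSet_tube).mono fun w hw u hu => ?_⟩
  have h1 := enorm_toeplitzIntegrand_le hξ f hz hw (le_norm_rho_of_mem_disc hz hu hw)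
    (disc_subset_tube hz hu)
  rw [← ofReal_norm, ← ofReal_norm, ← ENNReal.ofReal_ofNat 2,
    ENNReal.ofReal_rpow_of_pos two_pos, ← ENNReal.ofReal_mul (by positivity)] at h1
  exact (ENNReal.ofReal_le_ofReal_iff (by positivity)).1 h1

/-- Since ρ(w,a) is the conjugate of ρ(a,w), off the branch cut, the test function is the conjugate
of the kernel and their product is a squared modulus. -/
theorem toeplitzIntegrand_testFun {ξ : ℝ} {a w : Cn n} (ha : a ∈ tube n) (hw : w ∈ tube n) :
    toeplitzIntegrand ξ (testFun a ((n : ℝ) + 1 + ξ)) a w =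
      ((‖rho a w‖ ^ (-(2 * ((n : ℝ) + 1 + ξ))) : ℝ) : ℂ) := by
  set N : ℝ := (n : ℝ) + 1 + ξ
  have h := norm_rho_pos ha hw
  have hslit := rho_mem_slitPlane ha hw
  have h1 : rho w a ^ ((-N : ℝ) : ℂ) = conj (rho a w ^ ((-N : ℝ) : ℂ)) := by
    rw [← rho_conj, Complex.conj_cpow _ _ (Complex.slitPlane_arg_ne_pi hslit), Complex.conj_ofReal]
  rw [toeplitzIntegrand, testFun, h1, div_eq_mul_inv, ← Complex.cpow_neg, ← Complex.ofReal_neg,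
    mul_comm, Complex.mul_conj, Complex.normSq_eq_norm_sq, Complex.norm_cpow_real]
  congr 1
  rw [← Real.rpow_natCast, ← Real.rpow_mul h.le]
  congr 1
  push_cast
  ring

/-- A positive integrand does not cancel, so |T f(a)| is the full integral. Absolute convergence is
essential, because the Bochner integral of a non-integrable function is 0 by convention. -/
theorem lintegral_rho_eq_enorm_toeplitz {ξ : ℝ} {a : Cn n} (ha : a ∈ tube n) {μ : Measure (Cn n)}
    (hint : IntegrableOn (toeplitzIntegrand ξ (testFun a ((n : ℝ) + 1 + ξ)) a) (tube n) μ) :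
    ∫⁻ w in tube n, ‖rho a w‖ₑ ^ (-(2 * ((n : ℝ) + 1 + ξ))) ∂μ =
      ‖toeplitz μ ξ (testFun a ((n : ℝ) + 1 + ξ)) a‖ₑ := by
  set F := toeplitzIntegrand ξ (testFun a ((n : ℝ) + 1 + ξ)) a with hF
  have h1 : toeplitz μ ξ (testFun a ((n : ℝ) + 1 + ξ)) a = ((∫ w in tube n, ‖F w‖ ∂μ : ℝ) : ℂ) := by
    rw [← integral_complex_ofReal]
    refine setIntegral_congr_fun measurableSet_tube fun w hw => ?_
    have := norm_rho_pos ha hw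
    simp only [hF, toeplitzIntegrand_testFun ha hw, Complex.norm_real]
    rw [Real.norm_of_nonneg (by positivity)]
  rw [h1, ← ofReal_norm, Complex.norm_real, Real.norm_of_nonneg (integral_nonneg fun _ => by
    positivity), ofReal_integral_norm_eq_lintegral_enorm hint]
  refine setLIntegral_congr_fun measurableSet_tube fun w hw => ?_
  have := norm_rho_pos ha hw
  simp only [hF, toeplitzIntegrand_testFun ha hw]
  rw [← ofReal_norm (_ : ℂ), ← ofReal_norm (_ : ℂ), Complex.norm_real,
    Real.norm_of_nonneg (by positivity), ENNReal.ofReal_rpow_of_pos this]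

/-- The growth estimate in terms of the norm. -/
theorem exists_enorm_le_bergmanNorm (n : ℕ) [NeZero n] {p : ℝ} (hp : 0 < p) (α : ℝ) :
    ∃ K : ℝ≥0, 0 < K ∧ ∀ f : Cn n → ℂ, DifferentiableOn ℂ f (tube n) → ∀ a ∈ tube n,
      ‖f a‖ₑ ≤ K * bergmanNorm p α f * weight a ^ (-((n + 1 + α) / p)) := by
  obtain ⟨K, hK, h⟩ := exists_enorm_rpow_mul_weight_le_lintegral_tube n α
  refine ⟨K ^ (1 / p), by positivity, fun f hf a ha => ?_⟩
  have h1 := h f hf p hp a ha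
  have hw0 : weight a ^ ((n : ℝ) + 1 + α) ≠ 0 := by simp [weight_ne_zero ha, weight_ne_top a]
  have hwt : weight a ^ ((n : ℝ) + 1 + α) ≠ ∞ := by simp [weight_ne_zero ha, weight_ne_top a]
  rw [← bergmanNorm_rpow hp, ← ENNReal.le_div_iff_mul_le (Or.inl hw0) (Or.inl hwt)] at h1
  rw [← ENNReal.rpow_le_rpow_iff hp]
  refine h1.trans_eq ?_
  rw [ENNReal.mul_rpow_of_nonneg _ _ hp.le, ENNReal.mul_rpow_of_nonneg _ _ hp.le,
    ENNReal.coe_rpow_of_nonneg _ (by positivity), ← ENNReal.rpow_mul, ← ENNReal.rpow_mul,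
    one_div_mul_cancel hp.ne', ENNReal.rpow_one, neg_mul, div_mul_cancel₀ _ hp.ne',
    ENNReal.rpow_neg, div_eq_mul_inv]

/-- Boundedness of the Toeplitz operator implies the geometric condition. -/
theorem exists_geometricNorm_le_of_toeplitzBoundedBy (n : ℕ) [NeZero n] {p₁ α₁ p₂ α₂ ξ : ℝ}
    (hp₁ : 0 < p₁) (hp₂ : 0 < p₂) (hα₁ : -1 < α₁) (hξ : 0 ≤ (n : ℝ) + 1 + ξ)
    (h : (n : ℝ) + 1 + α₁ < ((n : ℝ) + 1 + ξ) * p₁) :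
    ∃ K : ℝ≥0, 0 < K ∧ ∀ (μ : Measure (Cn n)) (C : ℝ≥0), ToeplitzBoundedBy p₁ α₁ p₂ α₂ ξ μ C →
      geometricNorm ((n : ℝ) + 1 + ξ + (n + 1 + α₁) / p₁ - (n + 1 + α₂) / p₂) μ ≤ K * C := by
  obtain ⟨K₁, hK₁, h₁⟩ := exists_lintegral_weight_le n hα₁ h
  obtain ⟨K₂, hK₂, h₂⟩ := exists_enorm_le_bergmanNorm n hp₂ α₂
  set N : ℝ := (n : ℝ) + 1 + ξ with hN
  refine ⟨2 ^ (2 * N) * K₂ * K₁ ^ (1 / p₁), by positivity, fun μ C hT => ?_⟩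
  refine geometricNorm_le fun a ha => ?_
  have hnorm : bergmanNorm p₁ α₁ (testFun a N) ≤
      K₁ ^ (1 / p₁) * weight a ^ ((n + 1 + α₁) / p₁ - N) := by
    rw [← ENNReal.rpow_le_rpow_iff hp₁, bergmanNorm_rpow hp₁, lintegral_testFun ha,
      ENNReal.mul_rpow_of_nonneg _ _ hp₁.le, ← ENNReal.rpow_mul, ← ENNReal.rpow_mul,
      one_div_mul_cancel hp₁.ne', ENNReal.rpow_one, sub_mul, div_mul_cancel₀ _ hp₁.ne']
    exact h₁ a ha
  have hmem : testFun a N ∈ BergmanSpace n p₁ α₁ := by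
    refine ⟨differentiableOn_testFun ha N, hnorm.trans_lt (ENNReal.mul_lt_top ?_ ?_)⟩
    · exact ENNReal.rpow_lt_top_of_nonneg (by positivity) (by simp)
    · exact lt_top_iff_ne_top.2 (by simp [weight_ne_zero ha, weight_ne_top a])
  obtain ⟨hint, hTf, hTle⟩ := hT _ hmem
  have h3 := measure_dualDisc_le_lintegral μ ha (t := 2 * N) (by positivity)
  rw [lintegral_rho_eq_enorm_toeplitz ha (hint a ha)] at h3
  -- The exponents add up to κ: 2N from the measure bound, (n+1+α₁)/p₁ - N from the norm of the test
  -- function and -(n+1+α₂)/p₂ from the growth estimate.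
  calc μ (dualDisc a)
      ≤ 2 ^ (2 * N) * weight a ^ (2 * N) * (K₂ * (C * (K₁ ^ (1 / p₁) *
          weight a ^ ((n + 1 + α₁) / p₁ - N))) * weight a ^ (-((n + 1 + α₂) / p₂))) := by
        refine h3.trans (mul_le_mul_right ((h₂ _ hTf.1 a ha).trans ?_) _)
        gcongr
        exact hTle.trans (mul_le_mul_right hnorm _)
    _ = _ := by
        rw [show N + (n + 1 + α₁) / p₁ - (n + 1 + α₂) / p₂ =
            2 * N + ((n + 1 + α₁) / p₁ - N) + -((n + 1 + α₂) / p₂) by ring,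
          weight_rpow_add ha, weight_rpow_add ha]
        push_cast
        rw [ENNReal.coe_rpow_of_nonneg _ (by positivity),
          ENNReal.coe_rpow_of_nonneg _ (by positivity), ENNReal.coe_ofNat]
        ring

end Toeplitz
-- The Berezin operator: sufficiency of the geometric condition.
section Berezin
variable {n : ℕ} [NeZero n]

theorem aemeasurable_berezin {μ : Measure (Cn n)} [SFinite (μ.restrict (tube n))] (ξ : ℝ)
    {f : Cn n → ℂ} (hf : DifferentiableOn ℂ f (tube n)) :
    AEMeasurable (berezin μ ξ f) (volume.restrict (tube n)) := by
  have hfm : Measurable ((tube n).indicator f) :=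
    measurable_indicator_of_continuousOn measurableSet_tube hf.continuousOn
  have hm : Measurable fun x : Cn n × Cn n =>
      ‖(tube n).indicator f x.2‖ₑ / ‖rho x.1 x.2‖ₑ ^ ((n : ℝ) + 1 + ξ) :=
    (hfm.comp measurable_snd).enorm.div (measurable_enorm_rho.pow_const _)
  refine Measurable.aemeasurable ?_
  have h := hm.lintegral_prod_right' (ν := μ.restrict (tube n))
  have he : berezin μ ξ f = fun z => ∫⁻ w in tube n,
      ‖(tube n).indicator f w‖ₑ / ‖rho z w‖ₑ ^ ((n : ℝ) + 1 + ξ) ∂μ := by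
    funext z
    exact setLIntegral_congr_fun measurableSet_tube fun w hw => by
      rw [Set.indicator_of_mem hw]
  rw [he]
  exact h

/-- Domination of the Berezin operator by a weighted integral of the powers of a multiple of `f`. -/
theorem exists_berezin_le_lintegral (n : ℕ) [NeZero n] (ξ κ : ℝ) : ∃ K : ℝ≥0, 0 < K ∧
    ∀ (μ : Measure (Cn n)) [SFinite (μ.restrict (tube n))] (f : Cn n → ℂ),
      DifferentiableOn ℂ f (tube n) → ∀ z ∈ tube n,
      berezin μ ξ f z ≤ K * geometricNorm κ μ * ∫⁻ w in tube n,
        ‖f w * testFun z ((n : ℝ) + 1 + ξ) w‖ₑ ^ (1 : ℝ) * weight w ^ (κ - (n + 1)) := by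
  obtain ⟨K, hK, h⟩ := exists_lintegral_le_geometricNorm n
  refine ⟨K, hK, fun μ _ f hf z hz => ?_⟩
  -- Up to conjugation the kernel is holomorphic in w, so the Berezin integrand is the modulus of a
  -- holomorphic function and the estimate applies with q = 1.
  refine le_of_eq_of_le ?_ (h μ _ (hf.mul (differentiableOn_testFun hz ((n : ℝ) + 1 + ξ))) 1 κ
    one_pos)
  refine setLIntegral_congr_fun measurableSet_tube fun w hw => ?_
  dsimp only [Pi.mul_apply]
  rw [ENNReal.rpow_one, enorm_mul, enorm_testFun hz hw, ENNReal.rpow_neg, ← div_eq_mul_inv]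

/-- Integration of a kernel estimate in the outer variable. -/
theorem exists_lintegral_lintegral_le (n : ℕ) [NeZero n] {α s : ℝ} (hα : -1 < α)
    (hs : n + 1 + α < s) : ∃ K : ℝ≥0, 0 < K ∧
    ∀ f : Cn n → ℂ, DifferentiableOn ℂ f (tube n) → ∀ q e : ℝ,
      ∫⁻ z in tube n, weight z ^ α *
          (∫⁻ w in tube n, ‖f w‖ₑ ^ q * weight w ^ e * ‖rho z w‖ₑ ^ (-s)) ≤
        K * ∫⁻ w in tube n, ‖f w‖ₑ ^ q * weight w ^ (e + (n + 1 + α - s)) := by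
  obtain ⟨K, hK, h⟩ := exists_lintegral_weight_le n hα hs
  refine ⟨K, hK, fun f hf q e => ?_⟩
  set g : Cn n → ℝ≥0∞ := (tube n).indicator fun w => ‖f w‖ₑ ^ q * weight w ^ e with hg
  have hgm : Measurable g := measurable_indicator_enorm_rpow_mul_weight hf q e
  have hkm : Measurable fun x : Cn n × Cn n => weight x.1 ^ α * (g x.2 * ‖rho x.1 x.2‖ₑ ^ (-s)) :=
    ((measurable_weight'.comp measurable_fst).pow_const α).mul
      ((hgm.comp measurable_snd).mul (measurable_enorm_rho.pow_const (-s)))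
  calc _ = ∫⁻ z in tube n, (∫⁻ w in tube n, weight z ^ α * (g w * ‖rho z w‖ₑ ^ (-s))) := by
        refine setLIntegral_congr_fun measurableSet_tube fun z hz => ?_
        rw [← lintegral_const_mul' _ _ (by simp [weight_ne_zero hz, weight_ne_top z])]
        exact setLIntegral_congr_fun measurableSet_tube fun w hw => by
          rw [hg, Set.indicator_of_mem hw]
    _ = ∫⁻ w in tube n, (∫⁻ z in tube n, weight z ^ α * (g w * ‖rho z w‖ₑ ^ (-s))) :=
        lintegral_lintegral_swap hkm.aemeasurable
    _ ≤ ∫⁻ w in tube n, K * (‖f w‖ₑ ^ q * weight w ^ (e + (n + 1 + α - s))) := by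
        refine setLIntegral_mono' measurableSet_tube fun w hw => ?_
        have h1 : ∀ z, weight z ^ α * (g w * ‖rho z w‖ₑ ^ (-s)) =
            g w * (weight z ^ α * ‖rho w z‖ₑ ^ (-s)) := fun z => by
          rw [enorm_rho_comm z w, mul_left_comm]
        simp only [h1]
        have hm : Measurable fun z => weight z ^ α * ‖rho w z‖ₑ ^ (-s) :=
          (measurable_weight'.pow_const α).mul ((measurable_enorm_rho_right w).pow_const (-s))
        rw [lintegral_const_mul _ hm]
        refine (mul_le_mul_right (h w hw) _).trans_eq ?_
        rw [hg, Set.indicator_of_mem hw, weight_rpow_add hw]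
        ring
    _ = _ := lintegral_const_mul'' _ (aemeasurable_enorm_rpow_mul_weight hf q _ volume)

/-- The pointwise estimate of the Berezin operator for exponents at most `1`. -/
theorem exists_berezin_rpow_le_of_le_one (n : ℕ) [NeZero n] {p : ℝ} (hp : 0 < p) (hp1 : p ≤ 1)
    (ξ κ : ℝ) : ∃ K : ℝ≥0, 0 < K ∧
    ∀ (μ : Measure (Cn n)) [SFinite (μ.restrict (tube n))] (f : Cn n → ℂ),
      DifferentiableOn ℂ f (tube n) → ∀ z ∈ tube n,
      berezin μ ξ f z ^ p ≤ K * geometricNorm κ μ ^ p * ∫⁻ w in tube n,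
        ‖f w‖ₑ ^ p * weight w ^ (p * κ - (n + 1)) * ‖rho z w‖ₑ ^ (-((n + 1 + ξ) * p)) := by
  obtain ⟨K₁, hK₁, h₁⟩ := exists_berezin_le_lintegral n ξ κ
  obtain ⟨K₂, hK₂, h₂⟩ := exists_lintegral_le_rpow n (p * κ - (n + 1))
  refine ⟨K₁ ^ p * (K₂ ^ (1 / p - 1)) ^ p, by positivity, fun μ _ f hf z hz => ?_⟩
  -- As p ≤ 1, the embedding from exponent p to exponent 1 replaces Hölder's inequality.
  have h3 := h₂ _ (hf.mul (differentiableOn_testFun hz ((n : ℝ) + 1 + ξ))) p 1 (κ - (n + 1)) hp hp1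
    (by field_simp; ring)
  have h4 := (h₁ μ f hf z hz).trans (mul_le_mul_right h3 _)
  refine (ENNReal.rpow_le_rpow h4 hp.le).trans_eq ?_
  rw [ENNReal.mul_rpow_of_nonneg _ _ hp.le, ENNReal.mul_rpow_of_nonneg _ _ hp.le,
    ENNReal.mul_rpow_of_nonneg _ _ hp.le, ← ENNReal.rpow_mul _ (1 / p), one_div_mul_cancel hp.ne',
    ENNReal.rpow_one, ENNReal.coe_mul, ENNReal.coe_rpow_of_nonneg _ hp.le,
    ENNReal.coe_rpow_of_nonneg _ hp.le,
    ENNReal.coe_rpow_of_nonneg _ (sub_nonneg.2 ((one_le_div hp).2 hp1))]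
  have h5 : ∫⁻ w in tube n, ‖(f * testFun z ((n : ℝ) + 1 + ξ)) w‖ₑ ^ p *
      weight w ^ (p * κ - (n + 1)) = ∫⁻ w in tube n,
        ‖f w‖ₑ ^ p * weight w ^ (p * κ - (n + 1)) * ‖rho z w‖ₑ ^ (-((n + 1 + ξ) * p)) :=
    setLIntegral_congr_fun measurableSet_tube fun w hw => by
      rw [Pi.mul_apply, enorm_mul, enorm_testFun hz hw, ENNReal.mul_rpow_of_nonneg _ _ hp.le,
        ← ENNReal.rpow_mul, neg_mul]
      ring
  rw [h5]
  ring

/-- The pointwise estimate of the Berezin operator for exponents larger than `1`: Hölder's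
inequality and the Forelli–Rudin estimate. -/
theorem exists_berezin_rpow_le_of_one_lt (n : ℕ) [NeZero n] {p τ ξ : ℝ} (hp : 1 < p) (hτ : -1 < τ)
    (hτξ : τ < ξ) (κ : ℝ) : ∃ K : ℝ≥0, 0 < K ∧
    ∀ (μ : Measure (Cn n)) [SFinite (μ.restrict (tube n))] (f : Cn n → ℂ),
      DifferentiableOn ℂ f (tube n) → ∀ z ∈ tube n,
      berezin μ ξ f z ^ p ≤ K * geometricNorm κ μ ^ p * (weight z ^ ((τ - ξ) * (p - 1)) *
        ∫⁻ w in tube n, ‖f w‖ₑ ^ p * weight w ^ (p * (κ - (n + 1)) - τ * (p - 1)) *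
          ‖rho z w‖ₑ ^ (-(n + 1 + ξ))) := by
  obtain ⟨K₁, hK₁, h₁⟩ := exists_berezin_le_lintegral n ξ κ
  obtain ⟨K₂, hK₂, h₂⟩ := exists_lintegral_weight_le n hτ (s := n + 1 + ξ) (by linarith)
  refine ⟨K₁ ^ p * K₂ ^ (p - 1), by positivity, fun μ _ f hf z hz => ?_⟩
  have hp0 : 0 < p := by linarith
  have hpc := Real.HolderConjugate.conjExponent hp
  set q := p.conjExponent with hq
  have hq0 : 0 < q := hpc.symm.pos
  have hqp : 1 / q * p = p - 1 := by
    rw [hq, Real.conjExponent]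
    field_simp
  have hpq : p / q = p - 1 := by rw [← hqp]; ring
  set N : ℝ := n + 1 + ξ with hN
  -- The kernel is split as N/p + N/q, and the factor ρ^(τ/q) is moved to `B`, so that ∫B^q is a
  -- Forelli–Rudin integral with weight τ; this is where -1 < τ < ξ is needed.
  set A : Cn n → ℝ≥0∞ := fun w => ‖f w‖ₑ * weight w ^ (κ - (n + 1) - τ / q) *
    ‖rho z w‖ₑ ^ (-(N / p)) with hA
  set B : Cn n → ℝ≥0∞ := fun w => weight w ^ (τ / q) * ‖rho z w‖ₑ ^ (-(N / q)) with hB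
  have hkm := measurable_enorm_rho_right z
  have hAm : AEMeasurable A (volume.restrict (tube n)) :=
    ((aemeasurable_enorm hf volume).mul (measurable_weight'.pow_const _).aemeasurable).mul
      (hkm.pow_const _).aemeasurable
  have hBm : AEMeasurable B (volume.restrict (tube n)) :=
    (measurable_weight'.pow_const _).aemeasurable.mul (hkm.pow_const _).aemeasurable
  have hAB : ∫⁻ w in tube n, ‖f w * testFun z N w‖ₑ ^ (1 : ℝ) * weight w ^ (κ - (n + 1)) =
      ∫⁻ w in tube n, (A * B) w :=
    setLIntegral_congr_fun measurableSet_tube fun w hw => by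
      have e1 : weight w ^ (κ - (n + 1)) =
          weight w ^ (κ - (n + 1) - τ / q) * weight w ^ (τ / q) := by
        rw [← weight_rpow_add hw, sub_add_cancel]
      have e2 : ‖rho z w‖ₑ ^ (-N) = ‖rho z w‖ₑ ^ (-(N / p)) * ‖rho z w‖ₑ ^ (-(N / q)) := by
        rw [← ENNReal.rpow_add _ _ (enorm_rho_ne_zero hz hw) enorm_ne_top]
        congr 1
        have := hpc.inv_add_inv_eq_one
        rw [div_eq_mul_inv, div_eq_mul_inv]
        linear_combination N * this
      rw [ENNReal.rpow_one, enorm_mul, enorm_testFun hz hw, e1, e2]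
      simp only [hA, hB, Pi.mul_apply]
      ring
  have hAp : ∫⁻ w in tube n, A w ^ p = ∫⁻ w in tube n,
      ‖f w‖ₑ ^ p * weight w ^ (p * (κ - (n + 1)) - τ * (p - 1)) * ‖rho z w‖ₑ ^ (-N) :=
    setLIntegral_congr_fun measurableSet_tube fun w hw => by
      simp only [hA]
      rw [ENNReal.mul_rpow_of_nonneg _ _ hp0.le, ENNReal.mul_rpow_of_nonneg _ _ hp0.le,
        ← ENNReal.rpow_mul, ← ENNReal.rpow_mul, neg_mul, div_mul_cancel₀ _ hp0.ne', ← hpq]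
      congr 3
      ring
  have hBq : ∫⁻ w in tube n, B w ^ q = ∫⁻ w in tube n, weight w ^ τ * ‖rho z w‖ₑ ^ (-N) :=
    setLIntegral_congr_fun measurableSet_tube fun w hw => by
      simp only [hB]
      rw [ENNReal.mul_rpow_of_nonneg _ _ hq0.le, ← ENNReal.rpow_mul, ← ENNReal.rpow_mul, neg_mul,
        div_mul_cancel₀ _ hq0.ne', div_mul_cancel₀ _ hq0.ne']
  have hH := ENNReal.lintegral_mul_le_Lp_mul_Lq (volume.restrict (tube n)) hpc hAm hBm
  rw [← hAB, hAp, hBq] at hH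
  have h4 := (h₁ μ f hf z hz).trans (mul_le_mul_right (hH.trans (mul_le_mul_right
    (ENNReal.rpow_le_rpow (h₂ z hz) (by positivity)) _)) _)
  refine (ENNReal.rpow_le_rpow h4 hp0.le).trans_eq ?_
  have hp1 : 0 ≤ p - 1 := by linarith
  rw [ENNReal.mul_rpow_of_nonneg _ _ hp0.le, ENNReal.mul_rpow_of_nonneg _ _ hp0.le,
    ENNReal.mul_rpow_of_nonneg _ _ hp0.le, ← ENNReal.rpow_mul _ (1 / p), one_div_mul_cancel hp0.ne',
    ENNReal.rpow_one, ← ENNReal.rpow_mul _ (1 / q), hqp, ENNReal.mul_rpow_of_nonneg _ _ hp1,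
    ← ENNReal.rpow_mul, ENNReal.coe_mul, ENNReal.coe_rpow_of_nonneg _ hp0.le,
    ENNReal.coe_rpow_of_nonneg _ hp1, show (n : ℝ) + 1 + τ - N = τ - ξ by rw [hN]; ring]
  ring

/-- A uniform formulation of the pointwise estimates. -/
theorem exists_berezin_rpow_le (n : ℕ) [NeZero n] {p α ξ : ℝ} (hp : 0 < p) (hα : -1 < α)
    (hξ : -1 < ξ) (h : (n : ℝ) * max 1 (1 / p) + (1 + α) / p < (n : ℝ) + 1 + ξ) (κ : ℝ) :
    ∃ b s e : ℝ, -1 < α + b ∧ n + 1 + (α + b) < s ∧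
      e + (n + 1 + (α + b) - s) = p * κ - (n + 1 + ξ) * p + α ∧ ∃ K : ℝ≥0, 0 < K ∧
    ∀ (μ : Measure (Cn n)) [SFinite (μ.restrict (tube n))] (f : Cn n → ℂ),
      DifferentiableOn ℂ f (tube n) → ∀ z ∈ tube n,
      berezin μ ξ f z ^ p ≤ K * geometricNorm κ μ ^ p * (weight z ^ b *
        ∫⁻ w in tube n, ‖f w‖ₑ ^ p * weight w ^ e * ‖rho z w‖ₑ ^ (-s)) := by
  rcases le_or_gt p 1 with hp1 | hp1
  · refine ⟨0, (n + 1 + ξ) * p, p * κ - (n + 1), by linarith, ?_, by ring, ?_⟩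
    · have h1 : (n : ℝ) * (1 / p) ≤ n * max 1 (1 / p) := by
        gcongr
        exact le_max_right _ _
      have h2 : (n : ℝ) * (1 / p) + (1 + α) / p < n + 1 + ξ := by linarith
      have h3 := mul_lt_mul_of_pos_right h2 hp
      have h4 : ((n : ℝ) * (1 / p) + (1 + α) / p) * p = n + (1 + α) := by field_simp
      linarith
    · simpa only [ENNReal.rpow_zero, one_mul] using
        exists_berezin_rpow_le_of_le_one n hp hp1 ξ κ
  · have hp0 : 0 < p - 1 := by linarith
    have h1 : (1 + α) / p < 1 + ξ := by
      have : (n : ℝ) * 1 ≤ n * max 1 (1 / p) := by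
        gcongr
        exact le_max_left _ _
      linarith
    rw [div_lt_iff₀ hp] at h1
    -- Here τ = ξ - σ and b = -σ(p-1). The bounds 0 < σ < ξ+1 say -1 < τ < ξ; the other two permit
    -- the later integration in z. The window is nonempty because ξ > -1, α > -1 and (1+α)/p < 1+ξ.
    obtain ⟨σ, hσ₁, hσ₂⟩ : ∃ σ, max 0 ((α - ξ) / (p - 1)) < σ ∧
        σ < min (ξ + 1) ((α + 1) / (p - 1)) := by
      refine exists_between (max_lt (lt_min (by linarith) (by apply div_pos <;> linarith))
        (lt_min ?_ ?_))
      · rw [div_lt_iff₀ hp0]; linarith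
      · gcongr; linarith
    have hσ0 := (le_max_left _ _).trans_lt hσ₁
    have hσ3 := (le_max_right _ _).trans_lt hσ₁
    have hσ4 := hσ₂.trans_le (min_le_left _ _)
    have hσ5 := hσ₂.trans_le (min_le_right _ _)
    rw [div_lt_iff₀ hp0] at hσ3
    rw [lt_div_iff₀ hp0] at hσ5
    refine ⟨(ξ - σ - ξ) * (p - 1), n + 1 + ξ, p * (κ - (n + 1)) - (ξ - σ) * (p - 1), by linarith,
      by linarith, by ring, ?_⟩
    exact exists_berezin_rpow_le_of_one_lt n hp1 (by linarith) (by linarith) κ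

/-- The geometric condition implies boundedness of the Berezin operator. -/
theorem exists_berezinBoundedBy (n : ℕ) [NeZero n] {p₁ p₂ α₁ α₂ ξ : ℝ} (hp₁ : 0 < p₁)
    (hp : p₁ ≤ p₂) (hα₂ : -1 < α₂) (hξ : -1 < ξ)
    (h : (n : ℝ) * max 1 (1 / p₂) + (1 + α₂) / p₂ < (n : ℝ) + 1 + ξ) :
    ∃ K : ℝ≥0, 0 < K ∧ ∀ μ ∈ MPlus n, ∀ M : ℝ≥0,
      geometricNorm ((n : ℝ) + 1 + ξ + (n + 1 + α₁) / p₁ - (n + 1 + α₂) / p₂) μ ≤ M →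
      BerezinBoundedBy p₁ α₁ p₂ α₂ ξ μ (K * M) := by
  have hp₂ : 0 < p₂ := hp₁.trans_le hp
  set κ : ℝ := (n : ℝ) + 1 + ξ + (n + 1 + α₁) / p₁ - (n + 1 + α₂) / p₂ with hκ
  obtain ⟨b, s, e, hb, hs, he, K₁, hK₁, h₁⟩ := exists_berezin_rpow_le n hp₂ hα₂ hξ h κ
  obtain ⟨K₂, hK₂, h₂⟩ := exists_lintegral_lintegral_le n hb hs
  obtain ⟨K₃, hK₃, h₃⟩ := exists_lintegral_le_rpow n α₁
  refine ⟨(K₁ * K₂ * K₃ ^ (p₂ / p₁ - 1)) ^ (1 / p₂), by positivity, fun μ hμ M hM f hf => ?_⟩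
  have := sFinite_restrict_of_mem_MPlus hμ
  have hle : weightedNorm p₂ α₂ (berezin μ ξ f) ≤
      ((K₁ * K₂ * K₃ ^ (p₂ / p₁ - 1)) ^ (1 / p₂) * M : ℝ≥0) * bergmanNorm p₁ α₁ f := by
    -- κ is made for this: the weight exponent left after both integrations is exactly the one of
    -- the embedding from A^{p₁}_{α₁} to exponent p₂.
    have h4 := h₃ f hf.1 p₁ p₂ (p₂ * κ - (n + 1 + ξ) * p₂ + α₂) hp₁ hp
      (by rw [hκ]; field_simp; ring)
    have hθ : 0 ≤ p₂ / p₁ - 1 := sub_nonneg.2 ((one_le_div hp₁).2 hp)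
    rw [← ENNReal.rpow_le_rpow_iff hp₂, weightedNorm_rpow hp₂]
    calc ∫⁻ z in tube n, berezin μ ξ f z ^ p₂ * weight z ^ α₂
        ≤ ∫⁻ z in tube n, K₁ * M ^ p₂ * (weight z ^ (α₂ + b) *
            (∫⁻ w in tube n, ‖f w‖ₑ ^ p₂ * weight w ^ e * ‖rho z w‖ₑ ^ (-s))) := by
          refine setLIntegral_mono' measurableSet_tube fun z hz => ?_
          have h5 : K₁ * geometricNorm κ μ ^ p₂ ≤ K₁ * (M : ℝ≥0∞) ^ p₂ :=
            mul_le_mul_right (ENNReal.rpow_le_rpow hM hp₂.le) _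
          refine (mul_le_mul_left ((h₁ μ f hf.1 z hz).trans (mul_le_mul_left h5 _)) _).trans_eq ?_
          rw [weight_rpow_add hz]
          ring
      _ = K₁ * M ^ p₂ * ∫⁻ z in tube n, weight z ^ (α₂ + b) *
            (∫⁻ w in tube n, ‖f w‖ₑ ^ p₂ * weight w ^ e * ‖rho z w‖ₑ ^ (-s)) :=
          lintegral_const_mul' _ _ (ENNReal.mul_ne_top (by simp)
            (ENNReal.rpow_ne_top_of_nonneg hp₂.le (by simp)))
      _ ≤ K₁ * M ^ p₂ * (K₂ * (K₃ ^ (p₂ / p₁ - 1) *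
            (∫⁻ w in tube n, ‖f w‖ₑ ^ p₁ * weight w ^ α₁) ^ (p₂ / p₁))) := by
          refine mul_le_mul_right ((h₂ f hf.1 p₂ e).trans (mul_le_mul_right ?_ _)) _
          rw [he]
          exact h4
      _ = _ := by
          rw [← bergmanNorm_rpow hp₁, ← ENNReal.rpow_mul, mul_div_cancel₀ _ hp₁.ne',
            ENNReal.mul_rpow_of_nonneg _ _ hp₂.le, ENNReal.coe_mul,
            ENNReal.mul_rpow_of_nonneg _ _ hp₂.le, ENNReal.coe_rpow_of_nonneg _ (by positivity),
            ← ENNReal.rpow_mul, one_div_mul_cancel hp₂.ne', ENNReal.rpow_one, ENNReal.coe_mul,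
            ENNReal.coe_mul, ENNReal.coe_rpow_of_nonneg _ hθ]
          ring
  exact ⟨⟨aemeasurable_berezin ξ hf.1, hle.trans_lt (ENNReal.mul_lt_top ENNReal.coe_lt_top hf.2)⟩, hle⟩

end Berezin
-- From bounds to operator norms.
section Norms
variable {n : ℕ} [NeZero n]

theorem toeplitzNorm_le_berezinNorm {p₁ α₁ p₂ α₂ ξ : ℝ} (hp₂ : 0 < p₂)
    (hξ : 0 ≤ (n : ℝ) + 1 + ξ) (μ : Measure (Cn n)) :
    toeplitzNorm p₁ α₁ p₂ α₂ ξ μ ≤ berezinNorm p₁ α₁ p₂ α₂ ξ μ :=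
  le_iInf₂ fun C hC => iInf₂_le C (hC.toeplitzBoundedBy hp₂ hξ)

theorem berezinNorm_le_of_forall {p₁ α₁ p₂ α₂ ξ : ℝ} {μ : Measure (Cn n)} {K : ℝ≥0} (hK : 0 < K)
    {M : ℝ≥0∞} (h : ∀ m : ℝ≥0, M ≤ m → BerezinBoundedBy p₁ α₁ p₂ α₂ ξ μ (K * m)) :
    berezinNorm p₁ α₁ p₂ α₂ ξ μ ≤ K * M := by
  rcases eq_or_ne M ∞ with rfl | hM
  -- For infinite M the claim is trivial only because K ≠ 0; in `ℝ≥0∞`, 0·∞ = 0.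
  · rw [ENNReal.mul_top (by simpa using hK.ne')]
    exact le_top
  · lift M to ℝ≥0 using hM
    exact (iInf₂_le _ (h M le_rfl)).trans_eq (ENNReal.coe_mul _ _)

theorem le_mul_toeplitzNorm_of_forall {p₁ α₁ p₂ α₂ ξ : ℝ} {μ : Measure (Cn n)} {K : ℝ≥0}
    (hK : 0 < K) {M : ℝ≥0∞}
    (h : ∀ C : ℝ≥0, ToeplitzBoundedBy p₁ α₁ p₂ α₂ ξ μ C → M ≤ K * C) :
    M ≤ K * toeplitzNorm p₁ α₁ p₂ α₂ ξ μ := by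
  have hK0 : (K : ℝ≥0∞) ≠ 0 := by simpa using hK.ne'
  rw [mul_comm, ← ENNReal.div_le_iff hK0 ENNReal.coe_ne_top]
  refine le_iInf₂ fun C hC => ?_
  rw [ENNReal.div_le_iff hK0 ENNReal.coe_ne_top, mul_comm]
  exact h C hC

theorem carlesonNorm_le_of_forall {p q γ : ℝ} (hq : 0 < q) {μ : Measure (Cn n)} {C : ℝ≥0∞}
    (h : ∀ f ∈ BergmanSpace n p γ, ∫⁻ z in tube n, ‖f z‖ₑ ^ q ∂μ ≤ C * bergmanNorm p γ f ^ q) :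
    carlesonNorm p q γ μ ≤ C :=
  iSup₂_le fun f hf => iSup_le fun hf1 => (h f hf).trans <|
    mul_le_of_le_one_right' (ENNReal.rpow_le_one hf1 hq.le)

end Norms
end TubeBergman

/-! ### The main theorem. -/

open TubeBergman in
theorem theorem5p1 (n : ℕ) [NeZero n] (p₁ p₂ α₁ α₂ ξ : ℝ)
    (hp₁ : 0 < p₁) (hp : p₁ ≤ p₂) (hα₁ : -1 < α₁) (hα₂ : -1 < α₂) (hξ : -1 < ξ)
    (h₁ : (n : ℝ) * max 1 (1 / p₁) + (1 + α₁) / p₁ < (n : ℝ) + 1 + ξ)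
    (h₂ : (n : ℝ) * max 1 (1 / p₂) + (1 + α₂) / p₂ < (n : ℝ) + 1 + ξ)
    (lam γ : ℝ) (hlam : lam = 1 + 1 / p₁ - 1 / p₂)
    (hγ : γ = 1 / lam * (ξ + α₁ / p₁ - α₂ / p₂)) :
    (∀ μ ∈ TubeBergman.MPlus n,
      List.TFAE
        [TubeBergman.BerezinBounded p₁ α₁ p₂ α₂ ξ μ,
         TubeBergman.ToeplitzBounded p₁ α₁ p₂ α₂ ξ μ,
         TubeBergman.IsCarleson lam γ μ]) ∧
    (∃ C : ℝ≥0, 0 < C ∧ ∀ μ ∈ TubeBergman.MPlus n, ∀ p q : ℝ, 0 < p → 0 < q → q / p = lam →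
      TubeBergman.toeplitzNorm p₁ α₁ p₂ α₂ ξ μ ≤ C * TubeBergman.berezinNorm p₁ α₁ p₂ α₂ ξ μ ∧
      TubeBergman.berezinNorm p₁ α₁ p₂ α₂ ξ μ ≤ C * TubeBergman.toeplitzNorm p₁ α₁ p₂ α₂ ξ μ ∧
      TubeBergman.toeplitzNorm p₁ α₁ p₂ α₂ ξ μ ≤ C * TubeBergman.carlesonNorm p q γ μ ∧
      TubeBergman.carlesonNorm p q γ μ ≤ C * TubeBergman.toeplitzNorm p₁ α₁ p₂ α₂ ξ μ) := by
  have hn : (0 : ℝ) ≤ n := n.cast_nonneg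
  have hp₂ : 0 < p₂ := hp₁.trans_le hp
  have hN : 0 ≤ (n : ℝ) + 1 + ξ := by linarith
  have hlam1 : 1 ≤ lam := by
    have := one_div_le_one_div_of_le hp₁ hp
    linarith
  have hlam0 : 0 < lam := by linarith
  have hlγ : lam * γ = ξ + α₁ / p₁ - α₂ / p₂ := by
    rw [hγ]; field_simp
  have hκ : lam * (n + 1 + γ) = (n : ℝ) + 1 + ξ + (n + 1 + α₁) / p₁ - (n + 1 + α₂) / p₂ := by
    rw [mul_add, hlγ, hlam]; ring
  -- λ(1+γ) = (1+ξ) + (1+α₁)/p₁ - (1+α₂)/p₂, where the hypothesis for i = 2 makes the last term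
  -- smaller than 1+ξ.
  have hγ1 : -1 < γ := by
    have h3 : (1 + α₂) / p₂ < 1 + ξ := by
      have : (n : ℝ) * 1 ≤ n * max 1 (1 / p₂) := by
        gcongr
        exact le_max_left _ _
      linarith
    have h4 : 0 < (1 + α₁) / p₁ := div_pos (by linarith) hp₁
    have h5 : 0 < lam * (1 + γ) := by
      rw [mul_add, hlγ, hlam]
      rw [add_div] at h3 h4
      linarith
    linarith [pos_of_mul_pos_right h5 hlam0.le]
  have hN₁ : (n : ℝ) + 1 + α₁ < (n + 1 + ξ) * p₁ := by
    have h3 : (n : ℝ) * (1 / p₁) ≤ n * max 1 (1 / p₁) := by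
      gcongr
      exact le_max_right _ _
    have h4 : (n : ℝ) * (1 / p₁) + (1 + α₁) / p₁ < n + 1 + ξ := by linarith
    have h5 := mul_lt_mul_of_pos_right h4 hp₁
    have h6 : ((n : ℝ) * (1 / p₁) + (1 + α₁) / p₁) * p₁ = n + (1 + α₁) := by field_simp
    linarith
  obtain ⟨K₁, hK₁, hT⟩ := exists_geometricNorm_le_of_toeplitzBoundedBy n (α₂ := α₂) hp₁ hp₂ hα₁ hN
    hN₁
  obtain ⟨K₂, hK₂, hB⟩ := exists_berezinBoundedBy n (α₁ := α₁) hp₁ hp hα₂ hξ h₂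
  obtain ⟨K₃, hK₃, hC⟩ := exists_geometricNorm_le_carlesonNorm n hlam0 hγ1
  obtain ⟨K₄, hK₄, hE⟩ := exists_lintegral_le_geometricNorm_mul_bergmanNorm n hlam1 γ
  rw [← hκ] at hT hB
  -- Each of the four comparisons uses one summand of the constant.
  refine ⟨fun μ hμ => ?_, 1 + K₂ * K₁ + K₂ * K₃ + K₄ * K₁, by positivity,
    fun μ hμ p q hp0 hq0 hpq => ?_⟩
  · have := sFinite_restrict_of_mem_MPlus hμ
    tfae_have 1 → 2 := fun ⟨C, h⟩ => ⟨C, h.toeplitzBoundedBy hp₂ hN⟩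
    tfae_have 2 → 3 := fun ⟨C, h⟩ p q hp0 hq0 hpq => by
      refine ⟨K₄ * (K₁ * C), fun f hf => (hE μ p q hp0 hq0 hpq f hf.1).trans ?_⟩
      push_cast
      gcongr
      exact hT μ C h
    tfae_have 3 → 1 := fun h => by
      -- One pair of exponents is enough, since the geometric condition already follows from it.
      obtain ⟨C, hC'⟩ := h 1 lam one_pos hlam0 (div_one lam)
      refine ⟨K₂ * (K₃ * C), hB μ hμ (K₃ * C) ((hC μ 1 lam one_pos hlam0 (div_one lam)).trans ?_)⟩
      push_cast
      gcongr
      exact carlesonNorm_le_of_forall hlam0 hC'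
    tfae_finish
  · have := sFinite_restrict_of_mem_MPlus hμ
    have i1 := toeplitzNorm_le_berezinNorm (p₁ := p₁) (α₁ := α₁) (α₂ := α₂) hp₂ hN μ
    have i2 := berezinNorm_le_of_forall hK₂ (hB μ hμ)
    have i3 := le_mul_toeplitzNorm_of_forall hK₁ (hT μ)
    have i4 := hC μ p q hp0 hq0 hpq
    have i5 : carlesonNorm p q γ μ ≤ K₄ * geometricNorm (lam * (n + 1 + γ)) μ :=
      carlesonNorm_le_of_forall hq0 fun f hf => hE μ p q hp0 hq0 hpq f hf.1
    have mono : ∀ {c : ℝ≥0} {x y : ℝ≥0∞}, c ≤ 1 + K₂ * K₁ + K₂ * K₃ + K₄ * K₁ → x ≤ c * y →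
        x ≤ (1 + K₂ * K₁ + K₂ * K₃ + K₄ * K₁ : ℝ≥0) * y := fun hc hx =>
      hx.trans (mul_le_mul_left (ENNReal.coe_le_coe.2 hc) _)
    refine ⟨mono (c := 1) ?_ (by simpa using i1), mono (c := K₂ * K₁) ?_ ?_,
      mono (c := K₂ * K₃) ?_ ?_, mono (c := K₄ * K₁) ?_ ?_⟩
    · rw [add_assoc, add_assoc]; exact le_self_add
    · rw [add_assoc, add_comm 1, add_assoc]; exact le_self_add
    · rw [ENNReal.coe_mul, mul_assoc]
      exact i2.trans (mul_le_mul_right i3 _)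
    · rw [add_comm _ (K₂ * K₃), add_assoc]; exact le_self_add
    · rw [ENNReal.coe_mul, mul_assoc]
      exact i1.trans (i2.trans (mul_le_mul_right i4 _))
    · exact le_add_self
    · rw [ENNReal.coe_mul, mul_assoc]
      exact i5.trans (mul_le_mul_right i3 _)
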